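/- Let $K\ge 1$ and $\alpha>2$. A homeomorphism $\varphi:\Omega\to\widetilde\Omega$ between planar domains is called $K$-quasiconformal if $\varphi\in W^1_{2,\mathrm{loc}}(\Omega)$ and $|D\varphi(x)|^2\le K\,|J(x,\varphi)|$ for almost every $x\in\Omega$, where $D\varphi$ is the matrix of weak partial derivatives, $|D\varphi|$ its operator norm and $J(x,\varphi)=\det D\varphi(x)$. A simply connected domain $\Omega\subset\mathbb R^2$ is called $K$-quasiconformal $\alpha$-regular if there is a $K$-quasiconformal homeomorphism $\varphi$ of $\Omega$ onto the unit disc $\mathbb D$ with $$\int_{\mathbb D}|J(y,\varphi^{-1})|^{\alpha/2}\,dy<\infty .$$ Let $\Omega$ be a $K$-quasiconformal $\alpha$-regular domain, let $\varphi:\Omega\to\mathbb D$ be any $K$-quasiconformal homeomorphism onto $\mathbb D$ for which this integral is finite, and let $h(x)=|J(x,\varphi)|$. Let $\alpha/(\alpha-2)\le r<\infty$ and $s=\frac{\alpha-2}{\alpha}\,r$. Then every measurable $f:\Omega\to\mathbb R$ with $$\|f\|_{L_r(\Omega,h)}=\Big(\int_\Omega|f(x)|^r h(x)\,dx\Big)^{1/r}<\infty$$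 belongs to $L_s(\Omega)$, and $$\|f\|_{L_s(\Omega)}\le\Big(\int_{\mathbb D}|J(y,\varphi^{-1})|^{\alpha/2}\,dy\Big)^{\frac{2}{\alpha}\cdot\frac1s}\,\|f\|_{L_r(\Omega,h)} .$$ -/

import Mathlib

open MeasureTheory
open scoped ENNReal ContDiff

/-!
Planar domains are subsets of `ℂ`, regarded as the Euclidean plane `ℝ²`: the norm of `ℂ` is the
Euclidean one, `volume` is Lebesgue measure, derivatives are real-linear maps `ℂ →L[ℝ] ℂ` with the
operator norm, and `ContinuousLinearMap.det` is their determinant over `ℝ`.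
-/

namespace PlanarQC

noncomputable section

/-- `D` is a weak differential of `u` on the open set `U`: both are locally integrable on `U`, and
`∫_U ∂_v η · u = - ∫_U η · D v` for every test function `η ∈ C_c^∞(U)` and every direction `v`. -/
structure HasWeakFDeriv (U : Set ℂ) (u : ℂ → ℂ) (D : ℂ → ℂ →L[ℝ] ℂ) : Prop where
  locallyIntegrableOn : LocallyIntegrableOn u U
  locallyIntegrableOn_deriv : LocallyIntegrableOn D U
  integral_eq : ∀ η : ℂ → ℝ, ContDiff ℝ ∞ η → HasCompactSupport η → tsupport η ⊆ U →
    ∀ v : ℂ, ∫ x in U, (fderiv ℝ η x v) • u x = - ∫ x in U, η x • D x v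

/-- `u` is weakly differentiable on `U`. -/
def WeaklyDifferentiableOn (U : Set ℂ) (u : ℂ → ℂ) : Prop :=
  ∃ D : ℂ → ℂ →L[ℝ] ℂ, HasWeakFDeriv U u D

open Classical in
/-- The weak differential of `u` on `U` (the formal Jacobi matrix), determined almost everywhere
on `U` when `u` is weakly differentiable on `U`; by convention `0` otherwise. -/
def weakFDeriv (U : Set ℂ) (u : ℂ → ℂ) : ℂ → ℂ →L[ℝ] ℂ :=
  if h : WeaklyDifferentiableOn U u then h.choose else 0

/-- The Jacobian `J(x, u)`, the determinant of the formal Jacobi matrix of `u` on `U`. -/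
def jacobian (U : Set ℂ) (u : ℂ → ℂ) (x : ℂ) : ℝ :=
  (weakFDeriv U u x).det

/-- The local Sobolev class `W^1_{p,loc}(U)` of maps `U → ℝ²`. -/
structure MemSobolevLoc (U : Set ℂ) (p : ℝ≥0∞) (u : ℂ → ℂ) : Prop where
  weaklyDifferentiableOn : WeaklyDifferentiableOn U u
  memLp : ∀ C : Set ℂ, IsCompact C → C ⊆ U → MemLp u p (volume.restrict C)
  memLp_deriv : ∀ C : Set ℂ, IsCompact C → C ⊆ U →
    MemLp (weakFDeriv U u) p (volume.restrict C)

/-- The homeomorphism `φ`, from the open set `φ.source` onto the open set `φ.target`, is a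
`K`-quasiconformal mapping: it lies in `W^1_{2,loc}` and `|Dφ|² ≤ K |J(·, φ)|` almost everywhere. -/
structure IsQuasiconformal (K : ℝ) (φ : OpenPartialHomeomorph ℂ ℂ) : Prop where
  one_le : 1 ≤ K
  memSobolevLoc : MemSobolevLoc φ.source 2 φ
  distortion : ∀ᵐ x ∂(volume.restrict φ.source),
    ‖weakFDeriv φ.source φ x‖ ^ 2 ≤ K * |jacobian φ.source φ x|

/-- The open unit disc. -/
abbrev unitDisc : Set ℂ := Metric.ball 0 1

/-- The integral `∫_𝔻 |J(y, φ⁻¹)|^{α/2} dy` of a homeomorphism `φ` onto the unit disc. -/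
def inverseJacobianIntegral (α : ℝ) (φ : OpenPartialHomeomorph ℂ ℂ) : ℝ≥0∞ :=
  ∫⁻ y in unitDisc, ENNReal.ofReal (|jacobian unitDisc φ.symm y| ^ (α / 2))

/-- `φ : Ω → 𝔻` is a `K`-quasiconformal mapping with `∫_𝔻 |J(y, φ⁻¹)|^{α/2} dy < ∞`. -/
structure IsRegularMap (K α : ℝ) (Ω : Set ℂ) (φ : OpenPartialHomeomorph ℂ ℂ) : Prop where
  source_eq : φ.source = Ω
  target_eq : φ.target = unitDisc
  isQuasiconformal : IsQuasiconformal K φ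
  integral_lt_top : inverseJacobianIntegral α φ < ⊤

/-- `K`-quasiconformal `α`-regular domains. -/
structure IsRegularDomain (K α : ℝ) (Ω : Set ℂ) : Prop where
  isOpen : IsOpen Ω
  isSimplyConnected : IsSimplyConnected Ω
  two_lt : 2 < α
  exists_map : ∃ φ : OpenPartialHomeomorph ℂ ℂ, IsRegularMap K α Ω φ

/-- The norm `(∫_Ω |f|^p v dx)^{1/p}` of the weighted Lebesgue space `L_p(Ω, v)`. -/
def weightedNorm (p : ℝ) (Ω : Set ℂ) (v : ℂ → ℝ) (f : ℂ → ℝ) : ℝ≥0∞ :=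
  (∫⁻ x in Ω, ENNReal.ofReal (|f x| ^ p * v x)) ^ (1 / p)

/-- Membership in the weighted Lebesgue space `L_p(Ω, v)`. -/
def MemWeightedLp (p : ℝ) (Ω : Set ℂ) (v : ℂ → ℝ) (f : ℂ → ℝ) : Prop :=
  AEStronglyMeasurable f (volume.restrict Ω) ∧ weightedNorm p Ω v f < ⊤

end

end PlanarQC

/-!
Let `φ` be a homeomorphism of finite distortion onto a disc `B`, with weak differential `D` in
`L²_loc`. The minors of `D` are null Lagrangians: for a map into the plane,
`∫ det D · (∂_v g) ∘ φ = 0` for every test function `g` on `B`, by approximating `φ` by smooth maps.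
Hence `∫ det D · g ∘ φ = c ∫ g` for a constant `c`, the degree, which amounts to the area formula
`∫_E |det D| = |c| |φ(E)|`. As `D` does not vanish almost everywhere, `c ≠ 0`, and then `|c| ≥ 1`:
smooth approximations of `φ` have nonzero degree as well, hence cover every smaller disc, and
therefore `|B| ≤ ∫ |det D| = |c| |B|`.
The area formula makes `φ⁻¹` a map of the same kind, with differential `(D ∘ φ⁻¹)⁻¹` and degree
`1 / c` on small discs. Thus `|c| = 1` and `det D ≠ 0` almost everywhere, and the embedding is
Hölder's inequality with exponents `α / (α - 2)` and `α / 2` after the change of variables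
`∫_Ω |f|^s = ∫_𝔻 |f ∘ φ⁻¹|^s |J(·, φ⁻¹)|`.
-/

namespace PlanarQC

open Set Filter Topology Metric Convolution

noncomputable section

/-! ### Real-linear maps of the plane -/

theorem apply_eq_re_smul_add_im_smul {F : Type*} [AddCommGroup F] [Module ℝ F]
    [TopologicalSpace F] (A : ℂ →L[ℝ] F) (z : ℂ) :
    A z = z.re • A 1 + z.im • A Complex.I := by
  conv_lhs => rw [← Complex.re_add_im z, ← mul_one (z.re : ℂ)]
  rw [← Complex.real_smul, ← Complex.real_smul, map_add, map_smul, map_smul]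

theorem det_eq_im_conj_mul (A : ℂ →L[ℝ] ℂ) :
    A.det = ((starRingEnd ℂ) (A 1) * A Complex.I).im := by
  rw [ContinuousLinearMap.det, ← LinearMap.det_toMatrix Complex.basisOneI, Matrix.det_fin_two]
  simp only [LinearMap.toMatrix_apply, Complex.coe_basisOneI, Matrix.cons_val_zero,
    Matrix.cons_val_one, ContinuousLinearMap.coe_coe, Complex.coe_basisOneI_repr,
    Matrix.cons_val_fin_one, Complex.mul_im, Complex.conj_re, Complex.conj_im]
  ring

theorem abs_det_sub_le (A B : ℂ →L[ℝ] ℂ) : |A.det - B.det| ≤ ‖A - B‖ * (‖A‖ + ‖B‖) := by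
  have cross_le (S T : ℂ →L[ℝ] ℂ) : |((starRingEnd ℂ) (S 1) * T Complex.I).im| ≤ ‖S‖ * ‖T‖ := by
    refine (Complex.abs_im_le_norm _).trans ?_
    rw [norm_mul, RCLike.norm_conj]
    gcongr
    · simpa using S.le_opNorm 1
    · simpa using T.le_opNorm Complex.I
  calc |A.det - B.det|
      = |((starRingEnd ℂ) ((A - B) 1) * A Complex.I).im
          + ((starRingEnd ℂ) (B 1) * (A - B) Complex.I).im| := by
        rw [det_eq_im_conj_mul, det_eq_im_conj_mul]
        simp only [sub_apply, map_sub, sub_mul, mul_sub, Complex.sub_im]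
        ring_nf
    _ ≤ ‖A - B‖ * ‖A‖ + ‖B‖ * ‖A - B‖ :=
        (abs_add_le _ _).trans (add_le_add (cross_le _ _) (cross_le _ _))
    _ = ‖A - B‖ * (‖A‖ + ‖B‖) := by ring

theorem abs_det_le_norm_sq (A : ℂ →L[ℝ] ℂ) : |A.det| ≤ ‖A‖ ^ 2 := by
  have h := abs_det_sub_le A 0
  rwa [det_eq_im_conj_mul 0, zero_apply, map_zero, zero_mul, Complex.zero_im, sub_zero, sub_zero,
    norm_zero, add_zero, ← sq] at h

/-- The adjugate `tr A • id - A` of a real-linear map `A` of the plane. The adjugate of a `2 × 2`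
matrix depends linearly on the matrix, so that `adj` is itself a continuous linear map. -/
def adj : (ℂ →L[ℝ] ℂ) →L[ℝ] ℂ →L[ℝ] ℂ :=
  (Complex.reCLM ∘L ContinuousLinearMap.apply ℝ ℂ 1 +
    Complex.imCLM ∘L ContinuousLinearMap.apply ℝ ℂ Complex.I).smulRight
      (ContinuousLinearMap.id ℝ ℂ) - ContinuousLinearMap.id ℝ (ℂ →L[ℝ] ℂ)

theorem adj_apply (A : ℂ →L[ℝ] ℂ) (v : ℂ) :
    adj A v = ((A 1).re + (A Complex.I).im) • v - A v :=
  rfl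

theorem apply_adj (A : ℂ →L[ℝ] ℂ) (v : ℂ) : A (adj A v) = A.det • v := by
  rw [adj_apply, map_sub, map_smul, apply_eq_re_smul_add_im_smul A (A v),
    apply_eq_re_smul_add_im_smul A v, det_eq_im_conj_mul]
  apply Complex.ext <;> simp <;> ring

theorem adj_apply_apply (A : ℂ →L[ℝ] ℂ) (v : ℂ) : adj A (A v) = A.det • v := by
  rw [← apply_adj, adj_apply, adj_apply, map_sub, map_smul]

theorem inverse_eq_inv_det_smul_adj (A : ℂ →L[ℝ] ℂ) : A.inverse = A.det⁻¹ • adj A := by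
  by_cases h : A.det = 0
  · rw [h, inv_zero, ContinuousLinearMap.inverse_of_not_isInvertible, zero_smul ℝ (adj A)]
    rintro ⟨e, rfl⟩
    exact e.toLinearEquiv.isUnit_det'.ne_zero h
  · refine ContinuousLinearMap.inverse_eq (ContinuousLinearMap.ext fun v => ?_)
      (ContinuousLinearMap.ext fun v => ?_)
    · simp [apply_adj, h]
    · simp [adj_apply_apply, h]

theorem det_inverse (A : ℂ →L[ℝ] ℂ) : A.inverse.det = A.det⁻¹ := by
  have det_adj : (adj A).det = A.det := by
    rw [det_eq_im_conj_mul, det_eq_im_conj_mul A, adj_apply, adj_apply]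
    simp only [Complex.real_smul, map_sub, map_mul, Complex.conj_ofReal, Complex.mul_im,
      Complex.mul_re, Complex.sub_re, Complex.sub_im, Complex.ofReal_re, Complex.ofReal_im,
      Complex.conj_re, Complex.conj_im, Complex.one_re, Complex.one_im, Complex.I_re,
      Complex.I_im]
    ring
  rw [inverse_eq_inv_det_smul_adj, ContinuousLinearMap.det, ContinuousLinearMap.toLinearMap_smul,
    LinearMap.det_smul, ← ContinuousLinearMap.det, det_adj, Complex.finrank_real_complex, sq,
    mul_assoc]
  by_cases h : A.det = 0
  · simp [h]
  · rw [inv_mul_cancel₀ h, mul_one]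

theorem abs_det_mul_norm_inverse_sq_le {A : ℂ →L[ℝ] ℂ} {K : ℝ} (hK : 0 ≤ K)
    (h : ‖A‖ ^ 2 ≤ K * |A.det|) :
    |A.det| * ‖A.inverse‖ ^ 2 ≤ ‖adj‖ ^ 2 * K := by
  by_cases h0 : A.det = 0
  · rw [h0, abs_zero, zero_mul]
    positivity
  have : 0 < |A.det| := abs_pos.2 h0
  have h1 : ‖A.inverse‖ ≤ |A.det|⁻¹ * (‖adj‖ * ‖A‖) := by
    rw [inverse_eq_inv_det_smul_adj, norm_smul, norm_inv, Real.norm_eq_abs]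
    gcongr
    exact adj.le_opNorm A
  calc |A.det| * ‖A.inverse‖ ^ 2 ≤ |A.det| * (|A.det|⁻¹ * (‖adj‖ * ‖A‖)) ^ 2 := by gcongr
    _ = ‖adj‖ ^ 2 * (|A.det|⁻¹ * ‖A‖ ^ 2) := by field_simp
    _ ≤ ‖adj‖ ^ 2 * (|A.det|⁻¹ * (K * |A.det|)) := by gcongr
    _ = ‖adj‖ ^ 2 * K := by field_simp

theorem aestronglyMeasurable_inverse {X : Type*} [MeasurableSpace X] {μ : Measure X}
    {D : X → ℂ →L[ℝ] ℂ} (hD : AEStronglyMeasurable D μ) :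
    AEStronglyMeasurable (fun x => (D x).inverse) μ := by
  simp_rw [inverse_eq_inv_det_smul_adj]
  have hdet : AEMeasurable (fun x => (D x).det) μ :=
    (ContinuousLinearMap.continuous_det.comp_aestronglyMeasurable hD).aemeasurable
  exact hdet.inv.aestronglyMeasurable.smul (adj.continuous.comp_aestronglyMeasurable hD)

/-! ### Mollification in `Lᵖ` -/

section Mollification

variable {E F : Type*} [NormedAddCommGroup E]

theorem exists_seq_contDiffBump_tendsto_rOut :
    ∃ ρ : ℕ → ContDiffBump (0 : E), Tendsto (fun n => (ρ n).rOut) atTop (𝓝 0) :=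
  ⟨fun n => ⟨1 / (n + 1) / 2, 1 / (n + 1), by positivity, half_lt_self (by positivity)⟩,
    tendsto_one_div_add_atTop_nhds_zero_nat⟩

variable [NormedSpace ℝ E] [FiniteDimensional ℝ E] [MeasurableSpace E] [BorelSpace E]
  {μ : Measure E} [NormedAddCommGroup F]

theorem tendsto_eLpNorm_comp_sub_sub [μ.IsAddHaarMeasure] {p : ℝ≥0∞} [Fact (1 ≤ p)] (hp : p ≠ ⊤)
    {g : E → F} (hg : MemLp g p μ) :
    Tendsto (fun t => eLpNorm (fun x => g (x - t) - g x) p μ) (𝓝 0) (𝓝 0) := by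
  let G : C(E × E, E) := ⟨fun z => z.2 - z.1, by fun_prop⟩
  have hmp (t : E) : MeasurePreserving (G.curry t) μ μ := measurePreserving_sub_right μ t
  have hcont := ContinuousAt.compMeasurePreservingLp (f := fun _ : E => hg.toLp g)
    (g := fun t => G.curry t) (z := 0) continuousAt_const G.curry.continuous.continuousAt hmp hp
  have hcoe (t : E) : Lp.compMeasurePreserving (G.curry t) (hmp t) (hg.toLp g) =ᵐ[μ]
      fun x => g (x - t) :=
    (Lp.coeFn_compMeasurePreserving _ (hmp t)).trans
      ((hmp t).quasiMeasurePreserving.ae_eq_comp hg.coeFn_toLp)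
  refine (tendsto_iff_edist_tendsto_0.1 hcont.tendsto).congr fun t => ?_
  rw [Lp.edist_def]
  refine eLpNorm_congr_ae ?_
  filter_upwards [hcoe t, hcoe 0] with x ht h0
  rw [Pi.sub_apply, ht, h0, sub_zero]

variable [NormedSpace ℝ F]

/-- The probability measure with density `ρ / ∫ ρ` with respect to `μ`: averaging over its
translates is convolution with the normed bump function. -/
def bumpMeasure (ρ : ContDiffBump (0 : E)) (μ : Measure E) : Measure E :=
  μ.withDensity fun t => ENNReal.ofReal (ρ.normed μ t)

/-- The mollification of `g` by the bump function `ρ`. -/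
def mollify (ρ : ContDiffBump (0 : E)) (μ : Measure E) (g : E → F) : E → F :=
  ρ.normed μ ⋆[ContinuousLinearMap.lsmul ℝ ℝ, μ] g

variable (ρ : ContDiffBump (0 : E))

theorem mollify_apply (g : E → F) (x : E) :
    mollify ρ μ g x = ∫ t, g (x - t) ∂bumpMeasure ρ μ := by
  rw [mollify, convolution_lsmul, bumpMeasure, integral_withDensity_eq_integral_toReal_smul
    ρ.continuous_normed.measurable.ennreal_ofReal (by simp)]
  simp_rw [ENNReal.toReal_ofReal (ρ.nonneg_normed _)]

variable [μ.IsAddHaarMeasure]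

instance isProbabilityMeasure_bumpMeasure : IsProbabilityMeasure (bumpMeasure ρ μ) := by
  constructor
  rw [bumpMeasure, withDensity_apply _ MeasurableSet.univ, setLIntegral_univ,
    ← ofReal_integral_eq_lintegral_ofReal ρ.integrable_normed
      (Eventually.of_forall ρ.nonneg_normed), ρ.integral_normed, ENNReal.ofReal_one]

theorem ae_bumpMeasure_mem_ball : ∀ᵐ t ∂bumpMeasure ρ μ, t ∈ ball (0 : E) ρ.rOut := by
  rw [bumpMeasure, ae_withDensity_iff ρ.continuous_normed.measurable.ennreal_ofReal,
    ← ρ.support_normed_eq (μ := μ)]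
  filter_upwards with t ht h0
  simp [h0] at ht

theorem integrable_bumpMeasure_comp_sub {g : E → F} (hg : LocallyIntegrable g μ) (x : E) :
    Integrable (fun t => g (x - t)) (bumpMeasure ρ μ) := by
  rw [bumpMeasure, integrable_withDensity_iff_integrable_smul'
    ρ.continuous_normed.measurable.ennreal_ofReal (by simp)]
  simp_rw [ENNReal.toReal_ofReal (ρ.nonneg_normed _)]
  exact (ρ.hasCompactSupport_normed.convolutionExists_left (ContinuousLinearMap.lsmul ℝ ℝ)
    ρ.continuous_normed hg x).integrable

theorem enorm_mollify_sub_le [CompleteSpace F] {p : ℝ≥0∞} (hp : 1 ≤ p) {g : E → F}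
    (hg : LocallyIntegrable g μ) (x : E) :
    ‖mollify ρ μ g x - g x‖ₑ ≤ eLpNorm (fun t => g (x - t) - g x) p (bumpMeasure ρ μ) := by
  have hint := integrable_bumpMeasure_comp_sub ρ hg x
  calc ‖mollify ρ μ g x - g x‖ₑ = ‖∫ t, (g (x - t) - g x) ∂bumpMeasure ρ μ‖ₑ := by
        rw [integral_sub hint (integrable_const _), mollify_apply]; simp
    _ ≤ eLpNorm (fun t => g (x - t) - g x) 1 (bumpMeasure ρ μ) := by
        rw [eLpNorm_one_eq_lintegral_enorm]
        exact enorm_integral_le_lintegral_enorm _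
    _ ≤ _ := eLpNorm_le_eLpNorm_of_exponent_le hp
        (hint.aestronglyMeasurable.sub aestronglyMeasurable_const)

theorem eLpNorm_mollify_sub_le [CompleteSpace F] {p : ℝ≥0∞} (hp : 1 ≤ p) (hp' : p ≠ ⊤) {g : E → F}
    (hg : MemLp g p μ) {ε : ℝ≥0∞}
    (h : ∀ t ∈ ball (0 : E) ρ.rOut, eLpNorm (fun x => g (x - t) - g x) p μ ≤ ε) :
    eLpNorm (fun x => mollify ρ μ g x - g x) p μ ≤ ε := by
  lift p to NNReal using hp'
  have hp0 : p ≠ 0 := (zero_lt_one.trans_le (mod_cast hp : 1 ≤ p)).ne'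
  have hac : bumpMeasure ρ μ ≪ μ := withDensity_absolutelyContinuous _ _
  have hmeas : AEMeasurable (fun z : E × E => ‖g (z.1 - z.2) - g z.1‖ₑ ^ (p : ℝ))
      (μ.prod (bumpMeasure ρ μ)) := by
    refine AEMeasurable.mono_ac ?_ (Measure.AbsolutelyContinuous.rfl.prod hac)
    refine ((hg.1.comp_quasiMeasurePreserving ?_).sub hg.1.comp_fst).enorm.pow_const _
    exact quasiMeasurePreserving_sub_of_right_invariant _ _
  rw [← ENNReal.rpow_le_rpow_iff (z := p) (by positivity)]
  calc eLpNorm (fun x => mollify ρ μ g x - g x) p μ ^ (p : ℝ)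
      = ∫⁻ x, ‖mollify ρ μ g x - g x‖ₑ ^ (p : ℝ) ∂μ := eLpNorm_nnreal_pow_eq_lintegral hp0
    _ ≤ ∫⁻ x, ∫⁻ t, ‖g (x - t) - g x‖ₑ ^ (p : ℝ) ∂bumpMeasure ρ μ ∂μ := by
        refine lintegral_mono fun x => ?_
        rw [← eLpNorm_nnreal_pow_eq_lintegral hp0]
        gcongr
        exact enorm_mollify_sub_le ρ hp (hg.locallyIntegrable hp) x
    _ = ∫⁻ t, eLpNorm (fun x => g (x - t) - g x) p μ ^ (p : ℝ) ∂bumpMeasure ρ μ := by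
        rw [lintegral_lintegral_swap hmeas]
        simp_rw [eLpNorm_nnreal_pow_eq_lintegral hp0]
    _ ≤ ∫⁻ _, ε ^ (p : ℝ) ∂bumpMeasure ρ μ := by
        refine lintegral_mono_ae ?_
        filter_upwards [ae_bumpMeasure_mem_ball ρ] with t ht
        gcongr
        exact h t ht
    _ = ε ^ (p : ℝ) := by simp

theorem tendsto_eLpNorm_mollify_sub [CompleteSpace F] {p : ℝ≥0∞} [Fact (1 ≤ p)] (hp : p ≠ ⊤)
    {g : E → F} (hg : MemLp g p μ) {ι : Type*} {l : Filter ι} {ρ : ι → ContDiffBump (0 : E)}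
    (hρ : Tendsto (fun i => (ρ i).rOut) l (𝓝 0)) :
    Tendsto (fun i => eLpNorm (fun x => mollify (ρ i) μ g x - g x) p μ) l (𝓝 0) := by
  refine ENNReal.tendsto_nhds_zero.2 fun ε hε => ?_
  obtain ⟨δ, hδ, h⟩ := Metric.eventually_nhds_iff_ball.1
    ((tendsto_eLpNorm_comp_sub_sub hp hg).eventually_le_const hε)
  filter_upwards [hρ.eventually_le_const hδ] with i hi
  exact eLpNorm_mollify_sub_le (ρ i) Fact.out hp hg fun t ht => h t (ball_subset_ball hi ht)

theorem tendstoUniformlyOn_mollify_indicator [CompleteSpace F] {V C : Set E} (hV : IsCompact V)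
    {δ : ℝ} (hδ : 0 < δ) (hCV : cthickening δ C ⊆ V) {g : E → F} (hg : ContinuousOn g V)
    {ι : Type*} {l : Filter ι} {ρ : ι → ContDiffBump (0 : E)}
    (hρ : Tendsto (fun i => (ρ i).rOut) l (𝓝 0)) :
    TendstoUniformlyOn (fun i => mollify (ρ i) μ (V.indicator g)) g l C := by
  have hint : Integrable (V.indicator g) μ :=
    (hg.integrableOn_compact hV).integrable_indicator hV.measurableSet
  refine Metric.tendstoUniformlyOn_iff.2 fun ε hε => ?_
  obtain ⟨δ', hδ', hunif⟩ := Metric.uniformContinuousOn_iff_le.1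
    (hV.uniformContinuousOn_of_continuous hg) (ε / 2) (half_pos hε)
  filter_upwards [hρ.eventually_le_const hδ, hρ.eventually_le_const hδ'] with i hi hi' x hx
  have hball : closedBall x (ρ i).rOut ⊆ V :=
    (closedBall_subset_closedBall hi).trans ((closedBall_subset_cthickening hx δ).trans hCV)
  have hxV : x ∈ V := hball (mem_closedBall_self (ρ i).rOut_pos.le)
  have hle := (ρ i).dist_normed_convolution_le (μ := μ) (x₀ := x) (ε := ε / 2)
    hint.aestronglyMeasurable fun y hy => by
      have hyV : y ∈ V := hball (ball_subset_closedBall hy)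
      rw [indicator_of_mem hyV, indicator_of_mem hxV]
      exact hunif y hyV x hxV ((mem_ball.1 hy).le.trans hi')
  rw [indicator_of_mem hxV, dist_comm] at hle
  exact hle.trans_lt (half_lt_self hε)

theorem contDiff_mollify {g : E → F} (hg : LocallyIntegrable g μ) :
    ContDiff ℝ ∞ (mollify ρ μ g) :=
  ρ.hasCompactSupport_normed.contDiff_convolution_left (n := ⊤) _ ρ.contDiff_normed hg

end Mollification

/-! ### Smooth approximation of maps with a weak differential -/

section WeakDifferential

variable {U V C : Set ℂ} {u : ℂ → ℂ} {D : ℂ → ℂ →L[ℝ] ℂ}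

theorem integral_smul_indicator_eq_setIntegral {X F : Type*} [MeasurableSpace X] {μ : Measure X}
    [NormedAddCommGroup F] [NormedSpace ℝ F] {U V : Set X} (hU : MeasurableSet U) (hVU : V ⊆ U)
    {η : X → ℝ} (hη : Function.support η ⊆ V) (g : X → F) :
    ∫ x, η x • V.indicator g x ∂μ = ∫ x in U, η x • g x ∂μ := by
  rw [← integral_indicator hU]
  congr with x
  by_cases hx : x ∈ V
  · rw [indicator_of_mem hx, indicator_of_mem (hVU hx)]
  · simp [Function.notMem_support.1 fun h => hx (hη h), indicator]

theorem HasWeakFDeriv.integral_smul_indicator (hu : HasWeakFDeriv U u D) (hU : IsOpen U)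
    (hVU : V ⊆ U) {η : ℂ → ℝ} (hη : ContDiff ℝ ∞ η) (hηc : HasCompactSupport η)
    (hηV : tsupport η ⊆ V) (w : ℂ) :
    ∫ x, fderiv ℝ η x w • V.indicator u x = - ∫ x, η x • V.indicator D x w := by
  have hDw (x : ℂ) : V.indicator D x w = V.indicator (fun x => D x w) x := by
    by_cases hx : x ∈ V <;> simp [hx]
  simp_rw [hDw]
  rw [integral_smul_indicator_eq_setIntegral hU.measurableSet hVU,
    integral_smul_indicator_eq_setIntegral hU.measurableSet hVU,
    hu.integral_eq η hη hηc (hηV.trans hVU)]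
  · exact (subset_tsupport η).trans hηV
  · exact fun x hx => hηV (support_fderiv_subset ℝ fun h => hx (by simp [h]))

theorem HasWeakFDeriv.fderiv_mollify_indicator (hu : HasWeakFDeriv U u D) (hU : IsOpen U)
    (hVU : V ⊆ U) (hi : LocallyIntegrable (V.indicator u))
    (hDi : LocallyIntegrable (V.indicator D)) (ρ : ContDiffBump (0 : ℂ)) {x : ℂ}
    (hx : closedBall x ρ.rOut ⊆ V) :
    fderiv ℝ (mollify ρ volume (V.indicator u)) x = mollify ρ volume (V.indicator D) x := by
  have hρ : ContDiff ℝ ∞ (ρ.normed volume) := ρ.contDiff_normed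
  have hρc := ρ.hasCompactSupport_normed (μ := volume)
  have hex : ConvolutionExistsAt (ρ.normed volume) (V.indicator D) x
      (ContinuousLinearMap.lsmul ℝ ℝ) volume :=
    hρc.convolutionExists_left _ ρ.continuous_normed hDi x
  have hex' : ConvolutionExistsAt (fderiv ℝ (ρ.normed volume)) (V.indicator u) x
      ((ContinuousLinearMap.lsmul ℝ ℝ).precompL ℂ) volume :=
    (hρc.fderiv ℝ).convolutionExists_left _ (hρ.continuous_fderiv (by simp)) hi x
  ext1 w
  let η : ℂ → ℝ := fun t => ρ.normed volume (x - t)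
  have hη : ContDiff ℝ ∞ η := hρ.comp (contDiff_const.sub contDiff_id)
  have hηt : tsupport η ⊆ closedBall x ρ.rOut := by
    refine closure_minimal (fun t ht => ?_) isClosed_closedBall
    have : x - t ∈ Function.support (ρ.normed volume) := ht
    rw [ρ.support_normed_eq, mem_ball_zero_iff] at this
    rw [mem_closedBall, dist_comm, dist_eq_norm]
    exact this.le
  have hfderiv (t : ℂ) : fderiv ℝ η t w = -fderiv ℝ (ρ.normed volume) (x - t) w := by
    have hsub : HasFDerivAt (fun t : ℂ => x - t) (-ContinuousLinearMap.id ℝ ℂ) t :=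
      (hasFDerivAt_id t).const_sub x
    rw [show fderiv ℝ η t = _ from
      ((hρ.differentiable (by simp) (x - t)).hasFDerivAt.comp t hsub).fderiv]
    simp
  have hweak := hu.integral_smul_indicator hU hVU hη
    ((isCompact_closedBall x ρ.rOut).of_isClosed_subset (isClosed_tsupport _) hηt)
    (hηt.trans hx) w
  simp_rw [hfderiv, neg_smul, integral_neg, neg_inj] at hweak
  rwa [mollify, mollify, (hρc.hasFDerivAt_convolution_left (ContinuousLinearMap.lsmul ℝ ℝ)
    (hρ.of_le (by simp)) hi x).fderiv, convolution_eq_swap, convolution_eq_swap,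
    ContinuousLinearMap.integral_apply hex.integrable_swap,
    ContinuousLinearMap.integral_apply hex'.integrable_swap]

/-- `u` is continuous on `U` with weak differential `D`, square integrable on the compact subsets
of `U`. -/
structure HasWeakL2FDeriv (U : Set ℂ) (u : ℂ → ℂ) (D : ℂ → ℂ →L[ℝ] ℂ) : Prop
    extends HasWeakFDeriv U u D where
  continuousOn : ContinuousOn u U
  memLp_deriv : ∀ C : Set ℂ, IsCompact C → C ⊆ U → MemLp D 2 (volume.restrict C)

theorem HasWeakL2FDeriv.exists_seq_contDiff (hu : HasWeakL2FDeriv U u D) (hU : IsOpen U)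
    (hC : IsCompact C) (hCU : C ⊆ U) :
    ∃ w : ℕ → ℂ → ℂ, (∀ n, ContDiff ℝ ∞ (w n)) ∧ TendstoUniformlyOn w u atTop C ∧
      Tendsto (fun n => eLpNorm (fun x => fderiv ℝ (w n) x - D x) 2 (volume.restrict C))
        atTop (𝓝 0) := by
  obtain ⟨δ, hδ, hVU⟩ := hC.exists_cthickening_subset_open hU hCU
  set V := cthickening δ C
  have hV : IsCompact V := hC.cthickening
  have hi : Integrable (V.indicator u) :=
    ((hu.continuousOn.mono hVU).integrableOn_compact hV).integrable_indicator hV.measurableSet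
  have hD : MemLp (V.indicator D) 2 :=
    (memLp_indicator_iff_restrict (ε := ℂ →L[ℝ] ℂ) hV.measurableSet).2 (hu.memLp_deriv V hV hVU)
  obtain ⟨ρ, hρ⟩ := exists_seq_contDiffBump_tendsto_rOut (E := ℂ)
  refine ⟨_, fun n => contDiff_mollify (ρ n) hi.locallyIntegrable,
    tendstoUniformlyOn_mollify_indicator hV hδ subset_rfl (hu.continuousOn.mono hVU) hρ, ?_⟩
  refine tendsto_of_tendsto_of_tendsto_of_le_of_le' tendsto_const_nhds
    (tendsto_eLpNorm_mollify_sub (by simp) hD hρ) (Eventually.of_forall fun _ => zero_le)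
    ?_
  filter_upwards [hρ.eventually_le_const hδ] with n hn
  refine (eLpNorm_congr_ae ?_).trans_le (eLpNorm_mono_measure _ Measure.restrict_le_self)
  filter_upwards [ae_restrict_mem hC.measurableSet] with x hx
  have hball : closedBall x (ρ n).rOut ⊆ V :=
    (closedBall_subset_closedBall hn).trans (closedBall_subset_cthickening hx δ)
  rw [hu.fderiv_mollify_indicator hU hVU hi.locallyIntegrable
    (hD.locallyIntegrable (by norm_num)) (ρ n) hball,
    indicator_of_mem (hball (mem_closedBall_self (ρ n).rOut_pos.le))]

end WeakDifferential

/-! ### The Jacobian as a null Lagrangian -/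

section Limits

variable {X : Type*} [MeasurableSpace X] {μ : Measure X} {ι : Type*} {l : Filter ι}
  {E F : Type*} [NormedAddCommGroup E]

theorem tendsto_eLpNorm_one_of_tendsto_eLpNorm_two [IsFiniteMeasure μ] {g : ι → X → E}
    (hg : ∀ i, AEStronglyMeasurable (g i) μ) (hlim : Tendsto (fun i => eLpNorm (g i) 2 μ) l (𝓝 0)) :
    Tendsto (fun i => eLpNorm (g i) 1 μ) l (𝓝 0) := by
  refine tendsto_of_tendsto_of_tendsto_of_le_of_le tendsto_const_nhds ?_ (fun _ => zero_le)
    fun i => eLpNorm_le_eLpNorm_mul_rpow_measure_univ one_le_two (hg i)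
  simpa using ENNReal.Tendsto.mul_const hlim
    (Or.inr (ENNReal.rpow_ne_top_of_nonneg (by norm_num) (measure_ne_top μ univ)))

variable [NormedSpace ℝ E] [NormedAddCommGroup F] [NormedSpace ℝ F]

theorem integrable_clm_apply_of_norm_le {b : X → E →L[ℝ] F} {g : X → E} {M : ℝ}
    (hb : AEStronglyMeasurable b μ) (hM : ∀ x, ‖b x‖ ≤ M) (hg : Integrable g μ) :
    Integrable (fun x => b x (g x)) μ :=
  (hg.norm.const_mul M).mono'
    ((ContinuousLinearMap.id ℝ (E →L[ℝ] F)).aestronglyMeasurable_comp₂ hb hg.1)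
    (ae_of_all _ fun x => (b x).le_of_opNorm_le (hM x) (g x))

theorem norm_integral_clm_apply_le {b : X → E →L[ℝ] F} {g : X → E} {M : ℝ}
    (hM : ∀ x, ‖b x‖ ≤ M) (hg : Integrable g μ) :
    ‖∫ x, b x (g x) ∂μ‖ ≤ M * (eLpNorm g 1 μ).toReal := by
  rw [eLpNorm_one_eq_lintegral_enorm, ← integral_norm_eq_lintegral_enorm hg.1,
    ← integral_const_mul]
  exact norm_integral_le_of_norm_le (hg.norm.const_mul M)
    (ae_of_all _ fun x => (b x).le_of_opNorm_le (hM x) (g x))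

theorem tendsto_integral_clm_apply_of_tendsto_eLpNorm_one [l.IsCountablyGenerated]
    {b : ι → X → E →L[ℝ] F} {b' : X → E →L[ℝ] F} {g : ι → X → E} {g' : X → E}
    (hb : ∀ i, AEStronglyMeasurable (b i) μ) {M : ℝ} (hM : ∀ i x, ‖b i x‖ ≤ M)
    (hb' : ∀ᵐ x ∂μ, Tendsto (fun i => b i x) l (𝓝 (b' x)))
    (hg : ∀ i, AEStronglyMeasurable (g i) μ) (hg' : Integrable g' μ)
    (hlim : Tendsto (fun i => eLpNorm (g i - g') 1 μ) l (𝓝 0)) :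
    Tendsto (fun i => ∫ x, b i x (g i x) ∂μ) l (𝓝 (∫ x, b' x (g' x) ∂μ)) := by
  have hsub : ∀ᶠ i in l, Integrable (g i - g') μ := by
    filter_upwards [hlim.eventually_lt_const zero_lt_one] with i hi
    exact memLp_one_iff_integrable.1 ⟨(hg i).sub hg'.1, hi.trans ENNReal.one_lt_top⟩
  have hdom : Tendsto (fun i => ∫ x, b i x (g' x) ∂μ) l (𝓝 (∫ x, b' x (g' x) ∂μ)) := by
    refine tendsto_integral_filter_of_dominated_convergence (fun x => M * ‖g' x‖)
      (Eventually.of_forall fun i => (integrable_clm_apply_of_norm_le (hb i) (hM i) hg').1)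
      (Eventually.of_forall fun i => ae_of_all _ fun x => (b i x).le_of_opNorm_le (hM i x) _)
      (hg'.norm.const_mul M) ?_
    filter_upwards [hb'] with x hx using
      ((ContinuousLinearMap.apply ℝ F (g' x)).continuous.tendsto _).comp hx
  have hsmall : Tendsto (fun i => ∫ x, b i x ((g i - g') x) ∂μ) l (𝓝 0) := by
    refine squeeze_zero_norm' (hsub.mono fun i hi => norm_integral_clm_apply_le (hM i) hi) ?_
    simpa using ((ENNReal.tendsto_toReal ENNReal.zero_ne_top).comp hlim).const_mul M
  rw [← zero_add (∫ x, b' x (g' x) ∂μ)]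
  refine (hsmall.add hdom).congr' (hsub.mono fun i hi => ?_)
  rw [← integral_add (integrable_clm_apply_of_norm_le (hb i) (hM i) hi)
    (integrable_clm_apply_of_norm_le (hb i) (hM i) hg')]
  simp only [Pi.sub_apply, map_sub, sub_add_cancel]

theorem integrable_det_of_memLp_two {D : X → ℂ →L[ℝ] ℂ} (hD : MemLp D 2 μ) :
    Integrable (fun x => (D x).det) μ :=
  hD.integrable_norm_pow two_ne_zero |>.mono'
    (ContinuousLinearMap.continuous_det.comp_aestronglyMeasurable hD.1)
    (ae_of_all _ fun x => abs_det_le_norm_sq (D x))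

theorem tendsto_eLpNorm_one_det_sub {A : ι → X → ℂ →L[ℝ] ℂ} {D : X → ℂ →L[ℝ] ℂ}
    (hA : ∀ i, AEStronglyMeasurable (A i) μ) (hD : MemLp D 2 μ)
    (hlim : Tendsto (fun i => eLpNorm (A i - D) 2 μ) l (𝓝 0)) :
    Tendsto (fun i => eLpNorm ((fun x => (A i x).det) - fun x => (D x).det) 1 μ) l (𝓝 0) := by
  have hle (i : ι) : eLpNorm ((fun x => (A i x).det) - fun x => (D x).det) 1 μ ≤
      eLpNorm (A i - D) 2 μ * (eLpNorm (A i - D) 2 μ + (eLpNorm D 2 μ + eLpNorm D 2 μ)) := by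
    have hsub := ((hA i).sub hD.1).norm
    have hD' := hD.1.norm
    calc eLpNorm ((fun x => (A i x).det) - fun x => (D x).det) 1 μ
        ≤ eLpNorm ((fun x => ‖(A i - D) x‖) • fun x => ‖(A i - D) x‖ + (‖D x‖ + ‖D x‖)) 1 μ := by
          refine eLpNorm_mono_real fun x => (abs_det_sub_le _ _).trans ?_
          refine mul_le_mul_of_nonneg_left ?_ (norm_nonneg _)
          simp only [Pi.sub_apply]
          linarith [norm_le_norm_sub_add (A i x) (D x)]
      _ ≤ eLpNorm (fun x => ‖(A i - D) x‖) 2 μ *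
            eLpNorm (fun x => ‖(A i - D) x‖ + (‖D x‖ + ‖D x‖)) 2 μ :=
          eLpNorm_smul_le_mul_eLpNorm (hsub.add (hD'.add hD')) hsub
      _ ≤ _ := by
          rw [eLpNorm_norm]
          gcongr
          refine (eLpNorm_add_le hsub (hD'.add hD') one_le_two).trans ?_
          grw [eLpNorm_add_le hD' hD' one_le_two, eLpNorm_norm, eLpNorm_norm]
  have hbound : Tendsto (fun i => eLpNorm (A i - D) 2 μ *
      (eLpNorm (A i - D) 2 μ + (eLpNorm D 2 μ + eLpNorm D 2 μ))) l (𝓝 0) := by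
    have hfin : eLpNorm D 2 μ ≠ ⊤ := hD.2.ne
    simpa using ENNReal.Tendsto.mul hlim (Or.inr (by simp [hfin]))
      (hlim.add_const (eLpNorm D 2 μ + eLpNorm D 2 μ)) (Or.inr ENNReal.zero_ne_top)
  exact tendsto_of_tendsto_of_tendsto_of_le_of_le tendsto_const_nhds hbound
    (fun _ => zero_le) hle

end Limits

theorem fderiv_fderiv_apply_comm {E F : Type*} [NormedAddCommGroup E] [NormedSpace ℝ E]
    [NormedAddCommGroup F] [NormedSpace ℝ F] {g : E → F} (hg : ContDiff ℝ 2 g) (a b x : E) :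
    fderiv ℝ (fun y => fderiv ℝ g y a) x b = fderiv ℝ (fun y => fderiv ℝ g y b) x a := by
  have hdx : DifferentiableAt ℝ (fderiv ℝ g) x :=
    (hg.fderiv_right (m := 1) (by norm_num)).differentiable one_ne_zero x
  have happ (c d : E) :
      fderiv ℝ (fun y => fderiv ℝ g y c) x d = fderiv ℝ (fderiv ℝ g) x d c := by
    rw [fderiv_clm_apply hdx (differentiableAt_const c)]
    simp
  rw [happ, happ]
  exact hg.contDiffAt.isSymmSndFDerivAt (by simp) b a

theorem integral_fderiv_smul_fderiv_comm {E F : Type*} [NormedAddCommGroup E] [NormedSpace ℝ E]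
    [FiniteDimensional ℝ E] [MeasurableSpace E] [BorelSpace E] [NormedAddCommGroup F]
    [NormedSpace ℝ F] (μ : Measure E) [μ.IsAddHaarMeasure] {h : E → ℝ} {g : E → F}
    (hh : ContDiff ℝ 1 h) (hhc : HasCompactSupport h) (hg : ContDiff ℝ 2 g) (a b : E) :
    ∫ x, fderiv ℝ h x a • fderiv ℝ g x b ∂μ = ∫ x, fderiv ℝ h x b • fderiv ℝ g x a ∂μ := by
  have hparts (c d : E) : ∫ x, fderiv ℝ h x c • fderiv ℝ g x d ∂μ =
      -∫ x, h x • fderiv ℝ (fun y => fderiv ℝ g y d) x c ∂μ := by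
    have hgd : ContDiff ℝ 1 (fun y => fderiv ℝ g y d) :=
      (hg.fderiv_right (by norm_num)).clm_apply contDiff_const
    have := hgd.continuous
    have := hgd.continuous_fderiv one_ne_zero
    have := hh.continuous_fderiv one_ne_zero
    have := hh.continuous
    rw [← neg_eq_iff_eq_neg]
    symm
    apply integral_smul_fderiv_eq_neg_fderiv_smul_of_integrable
    · exact Continuous.integrable_of_hasCompactSupport (by fun_prop)
        (hhc.fderiv_apply ℝ c).smul_right
    · exact Continuous.integrable_of_hasCompactSupport (by fun_prop) hhc.smul_right
    · exact Continuous.integrable_of_hasCompactSupport (by fun_prop) hhc.smul_right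
    · exact fun x _ => hh.differentiable one_ne_zero x
    · exact fun x _ => hgd.differentiable one_ne_zero x
  simp_rw [hparts, fderiv_fderiv_apply_comm hg b a]

theorem apply_adj_eq_im (L : ℂ →L[ℝ] ℝ) (A : ℂ →L[ℝ] ℂ) (v : ℂ) :
    L (adj A v) = (starRingEnd ℂ v * (L 1 • A Complex.I - L Complex.I • A 1)).im := by
  rw [apply_eq_re_smul_add_im_smul L, adj_apply, apply_eq_re_smul_add_im_smul A v]
  simp only [Complex.real_smul, smul_eq_mul, Complex.sub_re, Complex.sub_im, Complex.add_re,
    Complex.add_im, Complex.mul_re, Complex.mul_im, Complex.ofReal_re, Complex.ofReal_im,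
    Complex.conj_re, Complex.conj_im]
  ring

theorem integral_fderiv_adj_fderiv_eq_zero {h : ℂ → ℝ} {w : ℂ → ℂ} (hh : ContDiff ℝ 1 h)
    (hhc : HasCompactSupport h) (hw : ContDiff ℝ 2 w) (v : ℂ) :
    ∫ x, fderiv ℝ h x (adj (fderiv ℝ w x) v) = 0 := by
  have hint (a b : ℂ) : Integrable (fun x => fderiv ℝ h x a • fderiv ℝ w x b) := by
    have := hh.continuous_fderiv one_ne_zero
    have := hw.continuous_fderiv two_ne_zero
    exact Continuous.integrable_of_hasCompactSupport (by fun_prop)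
      (hhc.fderiv_apply ℝ a).smul_right
  have hcomm := integral_fderiv_smul_fderiv_comm volume hh hhc hw 1 Complex.I
  simp_rw [apply_adj_eq_im]
  refine ((Complex.imCLM ∘L ContinuousLinearMap.mul ℝ ℂ (starRingEnd ℂ v)).integral_comp_comm
    ((hint 1 Complex.I).sub (hint Complex.I 1))).trans ?_
  rw [integral_sub' (hint _ _) (hint _ _), hcomm, sub_self, map_zero]

theorem fderiv_comp_mul_adj {F q : ℂ → ℝ} {w : ℂ → ℂ} {x : ℂ} (hF : DifferentiableAt ℝ F (w x))
    (hq : DifferentiableAt ℝ q x) (hw : DifferentiableAt ℝ w x) (v : ℂ) :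
    fderiv ℝ (fun x => F (w x) * q x) x (adj (fderiv ℝ w x) v) =
      F (w x) * fderiv ℝ q x (adj (fderiv ℝ w x) v) +
        q x * fderiv ℝ F (w x) v * (fderiv ℝ w x).det := by
  rw [fderiv_fun_mul (c := fun x => F (w x)) (hF.comp x hw) hq, fderiv_fun_comp x hF hw]
  simp only [add_apply, smul_apply, ContinuousLinearMap.comp_apply, apply_adj, map_smul,
    smul_eq_mul]
  ring

theorem integral_comp_mul_fderiv_adj_fderiv {F q : ℂ → ℝ} {w : ℂ → ℂ} (hF : ContDiff ℝ 1 F)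
    (hq : ContDiff ℝ 1 q) (hqc : HasCompactSupport q) (hw : ContDiff ℝ 2 w) (v : ℂ) :
    ∫ x, F (w x) * fderiv ℝ q x (adj (fderiv ℝ w x) v) =
      -∫ x, q x * fderiv ℝ F (w x) v * (fderiv ℝ w x).det := by
  have hzero := integral_fderiv_adj_fderiv_eq_zero (h := fun x => F (w x) * q x)
    ((hF.comp (hw.of_le one_le_two)).mul hq) hqc.mul_left hw v
  have := hF.continuous_fderiv one_ne_zero
  have := hq.continuous_fderiv one_ne_zero
  have hw' := hw.continuous_fderiv two_ne_zero
  have := hF.continuous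
  have := hq.continuous
  have := hw.continuous
  have hdet : Continuous fun x => (fderiv ℝ w x).det :=
    ContinuousLinearMap.continuous_det.comp hw'
  simp_rw [fun x => fderiv_comp_mul_adj (hF.differentiable one_ne_zero (w x))
    (hq.differentiable one_ne_zero x) (hw.differentiable two_ne_zero x) v] at hzero
  rw [integral_add] at hzero
  · exact eq_neg_of_add_eq_zero_left hzero
  · refine Continuous.integrable_of_hasCompactSupport (by fun_prop) ((hqc.fderiv ℝ).mono' ?_)
    exact fun x hx => subset_tsupport _ fun h0 => hx (by simp [h0])
  · exact Continuous.integrable_of_hasCompactSupport (by fun_prop) hqc.mul_right.mul_right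

section NullLagrangian

variable {U : Set ℂ} {u : ℂ → ℂ} {D : ℂ → ℂ →L[ℝ] ℂ} {F q : ℂ → ℝ}

theorem tendsto_integral_comp_mul_fderiv_adj {X : Set ℂ} {w : ℕ → ℂ → ℂ}
    {A : ℕ → ℂ → ℂ →L[ℝ] ℂ} (hX : MeasurableSet X) (hw : ∀ n, Continuous (w n))
    (hwu : TendstoUniformlyOn w u atTop X)
    (hA : ∀ n, AEStronglyMeasurable (A n) (volume.restrict X))
    (hD : IntegrableOn D X)
    (hlim : Tendsto (fun n => eLpNorm (A n - D) 1 (volume.restrict X)) atTop (𝓝 0))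
    (hF : ContDiff ℝ 1 F) (hFc : HasCompactSupport F) (hq : ContDiff ℝ 1 q)
    (hqc : HasCompactSupport q) (v : ℂ) :
    Tendsto (fun n => ∫ x in X, F (w n x) * fderiv ℝ q x (adj (A n x) v)) atTop
      (𝓝 (∫ x in X, F (u x) * fderiv ℝ q x (adj (D x) v))) := by
  obtain ⟨M, hM⟩ := hF.continuous.bounded_above_of_compact_support hFc
  have hq' := hq.continuous_fderiv one_ne_zero
  obtain ⟨N, hN⟩ := hq'.bounded_above_of_compact_support (hqc.fderiv ℝ)
  have hFcont := hF.continuous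
  refine tendsto_integral_clm_apply_of_tendsto_eLpNorm_one
    (b := fun n x => F (w n x) • fderiv ℝ q x ∘L adj.flip v)
    (b' := fun x => F (u x) • fderiv ℝ q x ∘L adj.flip v) (M := M * (N * ‖adj.flip v‖))
    (fun n => ?_) (fun n x => ?_) ?_ hA hD hlim
  · have hwc := hw n
    exact Continuous.aestronglyMeasurable (by fun_prop)
  · rw [norm_smul]
    gcongr
    · exact (norm_nonneg _).trans (hM 0)
    · exact hM _
    · exact (ContinuousLinearMap.opNorm_comp_le _ _).trans (by gcongr; exact hN x)
  · filter_upwards [ae_restrict_mem hX] with x hx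
    exact ((hFcont.tendsto _).comp (hwu.tendsto_at hx)).smul_const _

theorem tendsto_integral_mul_comp_mul {X : Set ℂ} {w : ℕ → ℂ → ℂ} {J : ℕ → ℂ → ℝ}
    {J' : ℂ → ℝ} (hX : MeasurableSet X) (hw : ∀ n, Continuous (w n))
    (hwu : TendstoUniformlyOn w u atTop X)
    (hJ : ∀ n, AEStronglyMeasurable (J n) (volume.restrict X))
    (hJ' : IntegrableOn J' X)
    (hlim : Tendsto (fun n => eLpNorm (J n - J') 1 (volume.restrict X)) atTop (𝓝 0))
    (hF : Continuous F) (hFc : HasCompactSupport F) (hq : Continuous q)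
    (hqc : HasCompactSupport q) :
    Tendsto (fun n => ∫ x in X, q x * F (w n x) * J n x) atTop
      (𝓝 (∫ x in X, q x * F (u x) * J' x)) := by
  obtain ⟨M, hM⟩ := hF.bounded_above_of_compact_support hFc
  obtain ⟨N, hN⟩ := hq.bounded_above_of_compact_support hqc
  have hlim' := tendsto_integral_clm_apply_of_tendsto_eLpNorm_one
    (b := fun n x => (q x * F (w n x)) • ContinuousLinearMap.id ℝ ℝ)
    (b' := fun x => (q x * F (u x)) • ContinuousLinearMap.id ℝ ℝ)
    (M := N * M) (fun n => ?_) (fun n x => ?_) ?_ hJ hJ' hlim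
  · simpa using hlim'
  · have hwc := hw n
    exact Continuous.aestronglyMeasurable (by fun_prop)
  · rw [norm_smul, norm_mul, ContinuousLinearMap.norm_id, mul_one]
    gcongr
    · exact (norm_nonneg _).trans (hN 0)
    · exact hN x
    · exact hM _
  · filter_upwards [ae_restrict_mem hX] with x hx
    exact (((hF.tendsto _).comp (hwu.tendsto_at hx)).const_mul _).smul_const _

theorem HasWeakL2FDeriv.integral_comp_mul_fderiv_adj (hu : HasWeakL2FDeriv U u D) (hU : IsOpen U)
    (hF : ContDiff ℝ 1 F) (hFc : HasCompactSupport F) (hq : ContDiff ℝ 1 q)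
    (hqc : HasCompactSupport q) (hqU : tsupport q ⊆ U) (v : ℂ) :
    ∫ x in U, F (u x) * fderiv ℝ q x (adj (D x) v) =
      -∫ x in U, q x * fderiv ℝ F (u x) v * (D x).det := by
  have hq0 {x : ℂ} (hx : x ∉ tsupport q) : q x = 0 := image_eq_zero_of_notMem_tsupport hx
  have hq0' {x : ℂ} (hx : x ∉ tsupport q) : fderiv ℝ q x = 0 :=
    image_eq_zero_of_notMem_tsupport fun h => hx (tsupport_fderiv_subset ℝ h)
  have hC : IsCompact (tsupport q) := hqc
  have hD := hu.memLp_deriv _ hC hqU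
  have : IsFiniteMeasure (volume.restrict (tsupport q)) :=
    isFiniteMeasure_restrict.2 hC.measure_lt_top.ne
  obtain ⟨w, hw, hwu, hwD⟩ := hu.exists_seq_contDiff hU hC hqU
  have hw2 (n : ℕ) : ContDiff ℝ 2 (w n) := contDiff_infty.1 (hw n) 2
  have hw' (n : ℕ) : Continuous (fderiv ℝ (w n)) := (hw2 n).continuous_fderiv two_ne_zero
  have hwm (n : ℕ) := (hw' n).aestronglyMeasurable (μ := volume.restrict (tsupport q))
  have hleft := tendsto_integral_comp_mul_fderiv_adj hC.measurableSet
    (fun n => (hw n).continuous) hwu hwm (hD.integrable one_le_two)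
    (tendsto_eLpNorm_one_of_tendsto_eLpNorm_two (fun n => (hwm n).sub hD.1) hwD) hF hFc hq hqc v
  have hright := tendsto_integral_mul_comp_mul (F := fun y => fderiv ℝ F y v) hC.measurableSet
    (fun n => (hw n).continuous) hwu
    (fun n => ContinuousLinearMap.continuous_det.comp_aestronglyMeasurable (hwm n))
    (integrable_det_of_memLp_two hD) (tendsto_eLpNorm_one_det_sub hwm hD hwD)
    ((hF.continuous_fderiv one_ne_zero).clm_apply continuous_const) (hFc.fderiv_apply ℝ v)
    hq.continuous hqc
  rw [setIntegral_eq_of_subset_of_forall_sdiff_eq_zero hU.measurableSet hqU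
      fun x hx => by simp [hq0' hx.2],
    setIntegral_eq_of_subset_of_forall_sdiff_eq_zero hU.measurableSet hqU
      fun x hx => by simp [hq0 hx.2]]
  refine tendsto_nhds_unique hleft (hright.neg.congr fun n => ?_)
  rw [setIntegral_eq_integral_of_forall_compl_eq_zero fun x hx => by simp [hq0 hx],
    setIntegral_eq_integral_of_forall_compl_eq_zero fun x hx => by simp [hq0' hx]]
  exact (integral_comp_mul_fderiv_adj_fderiv hF hq hqc (hw2 n) v).symm

end NullLagrangian

/-! ### The degree of a density along a map -/

section Degree

variable {E : Type*} [NormedAddCommGroup E] [NormedSpace ℝ E] [FiniteDimensional ℝ E]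
  [MeasurableSpace E] [BorelSpace E] {μ : Measure E} {X : Type*} [MeasurableSpace X]
  {m : Measure X} {u : X → E} {θ : X → ℝ} {B : Set E}

/-- The image under `u` of the signed measure `θ m` is `c μ` on the open set `B`, as tested against
continuous functions. When `θ` is the Jacobian determinant of `u`, the number `c` is the degree
of `u` over `B`. -/
def HasDegree (m : Measure X) (u : X → E) (θ : X → ℝ) (μ : Measure E) (B : Set E) (c : ℝ) : Prop :=
  ∀ g : E → ℝ, Continuous g → HasCompactSupport g → tsupport g ⊆ B →
    ∫ x, θ x * g (u x) ∂m = c * ∫ y, g y ∂μ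

theorem integrable_smul_comp_of_hasCompactSupport {F : Type*} [NormedAddCommGroup F]
    [NormedSpace ℝ F] (hu : AEMeasurable u m) (hθ : Integrable θ m) {g : E → F}
    (hg : Continuous g) (hgc : HasCompactSupport g) : Integrable (fun x => θ x • g (u x)) m := by
  obtain ⟨M, hM⟩ := hg.bounded_above_of_compact_support hgc
  exact hθ.smul_bdd M (hg.comp_aestronglyMeasurable hu.aestronglyMeasurable)
    (ae_of_all _ fun x => hM (u x))

theorem hasFDerivAt_integral_mul_comp_sub (hu : AEMeasurable u m) (hθ : Integrable θ m)
    {ρ : E → ℝ} (hρ : ContDiff ℝ 1 ρ) (hρc : HasCompactSupport ρ) (y : E) :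
    HasFDerivAt (fun y => ∫ x, θ x * ρ (u x - y) ∂m) (-∫ x, θ x • fderiv ℝ ρ (u x - y) ∂m) y := by
  have hρ' := hρ.continuous_fderiv one_ne_zero
  obtain ⟨M, hM⟩ := hρ'.bounded_above_of_compact_support (hρc.fderiv ℝ)
  have hint (y : E) : Integrable (fun x => θ x * ρ (u x - y)) m :=
    integrable_smul_comp_of_hasCompactSupport (hu.sub_const y) hθ hρ.continuous hρc
  have hint' : Integrable (fun x => θ x • fderiv ℝ ρ (u x - y)) m :=
    integrable_smul_comp_of_hasCompactSupport (hu.sub_const y) hθ hρ' (hρc.fderiv ℝ)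
  rw [← integral_neg]
  refine hasFDerivAt_integral_of_dominated_of_fderiv_le
    (F' := fun y x => -(θ x • fderiv ℝ ρ (u x - y))) (bound := fun x => ‖θ x‖ * M) univ_mem
    (Eventually.of_forall fun y => (hint y).1) (hint y) hint'.1.neg
    (ae_of_all _ fun x y _ => ?_) (hθ.norm.mul_const M) (ae_of_all _ fun x y _ => ?_)
  · rw [norm_neg, norm_smul]
    exact mul_le_mul_of_nonneg_left (hM _) (norm_nonneg _)
  · have hsub : HasFDerivAt (fun y => u x - y) (-ContinuousLinearMap.id ℝ E) y :=
      (hasFDerivAt_id y).const_sub (u x)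
    simpa using (((hρ.differentiable one_ne_zero _).hasFDerivAt.comp y hsub).const_mul (θ x))

theorem integral_mul_comp_sub_eq_of_integral_fderiv_eq_zero (hu : AEMeasurable u m)
    (hθ : Integrable θ m) {y₀ : E} {R : ℝ}
    (hzero : ∀ g : E → ℝ, ContDiff ℝ 1 g → HasCompactSupport g → tsupport g ⊆ ball y₀ R →
      ∀ v : E, ∫ x, θ x * fderiv ℝ g (u x) v ∂m = 0)
    {ρ : E → ℝ} (hρ : ContDiff ℝ 1 ρ) {δ : ℝ} (hρδ : tsupport ρ ⊆ closedBall 0 δ) {y z : E}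
    (hy : y ∈ ball y₀ (R - δ)) (hz : z ∈ ball y₀ (R - δ)) :
    ∫ x, θ x * ρ (u x - y) ∂m = ∫ x, θ x * ρ (u x - z) ∂m := by
  have hρc : HasCompactSupport ρ :=
    (isCompact_closedBall 0 δ).of_isClosed_subset (isClosed_tsupport ρ) hρδ
  have hderiv := hasFDerivAt_integral_mul_comp_sub hu hθ hρ hρc
  refine isOpen_ball.is_const_of_fderiv_eq_zero (𝕜 := ℝ) (convex_ball y₀ (R - δ)).isPreconnected
    (fun y _ => (hderiv y).differentiableAt.differentiableWithinAt) (fun y hy => ?_) hy hz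
  have htranslate : tsupport (fun w => ρ (w - y)) ⊆ closedBall y δ := by
    refine closure_minimal (fun w hw => ?_) isClosed_closedBall
    rw [mem_closedBall, dist_eq_norm, ← mem_closedBall_zero_iff]
    exact hρδ (subset_tsupport ρ hw)
  have hball : closedBall y δ ⊆ ball y₀ R :=
    closedBall_subset_ball' (by linarith [mem_ball.1 hy])
  ext v
  rw [(hderiv y).fderiv, neg_apply, ContinuousLinearMap.integral_apply
    (integrable_smul_comp_of_hasCompactSupport (hu.sub_const y) hθ
      (hρ.continuous_fderiv one_ne_zero) (hρc.fderiv ℝ))]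
  have hv := hzero (fun w => ρ (w - y)) (hρ.comp (contDiff_id.sub contDiff_const))
    ((isCompact_closedBall y δ).of_isClosed_subset (isClosed_tsupport _) htranslate)
    (htranslate.trans hball) v
  simp_rw [fderiv_comp_sub] at hv
  simpa using hv

variable [μ.IsAddHaarMeasure]

theorem integral_mul_mollify_comp [SFinite m] (hu : AEMeasurable u m) (hθ : Integrable θ m)
    (ρ : ContDiffBump (0 : E)) {g : E → ℝ} (hg : Continuous g) (hgc : HasCompactSupport g) :
    ∫ x, θ x * mollify ρ μ g (u x) ∂m =
      ∫ y, (∫ x, θ x * ρ.normed μ (u x - y) ∂m) * g y ∂μ := by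
  obtain ⟨M, hM⟩ := ρ.continuous_normed.bounded_above_of_compact_support
    (ρ.hasCompactSupport_normed (μ := μ))
  have hint : Integrable (Function.uncurry fun x y => θ x * ρ.normed μ (u x - y) * g y)
      (m.prod μ) := by
    have hsub : AEMeasurable (fun p : X × E => u p.1 - p.2) (m.prod μ) :=
      hu.comp_fst.sub measurable_snd.aemeasurable
    refine ((hθ.mul_prod (hg.integrable_of_hasCompactSupport hgc)).bdd_mul
      (ρ.continuous_normed.measurable.comp_aemeasurable hsub).aestronglyMeasurable
      (ae_of_all _ fun p => hM (u p.1 - p.2))).congr (ae_of_all _ fun p => ?_)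
    simp only [Function.uncurry, Function.comp_apply]
    ring
  calc ∫ x, θ x * mollify ρ μ g (u x) ∂m
      = ∫ x, ∫ y, θ x * ρ.normed μ (u x - y) * g y ∂μ ∂m := by
        simp_rw [mul_assoc, integral_const_mul, mollify, convolution_eq_swap]
        rfl
    _ = ∫ y, ∫ x, θ x * ρ.normed μ (u x - y) * g y ∂m ∂μ := integral_integral_swap hint
    _ = ∫ y, (∫ x, θ x * ρ.normed μ (u x - y) ∂m) * g y ∂μ := by simp_rw [integral_mul_const]

theorem tendsto_integral_mul_mollify_comp (hu : AEMeasurable u m) (hθ : Integrable θ m)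
    {ρ : ℕ → ContDiffBump (0 : E)} (hρ : Tendsto (fun n => (ρ n).rOut) atTop (𝓝 0)) {g : E → ℝ}
    (hg : Continuous g) (hgc : HasCompactSupport g) :
    Tendsto (fun n => ∫ x, θ x * mollify (ρ n) μ g (u x) ∂m) atTop
      (𝓝 (∫ x, θ x * g (u x) ∂m)) := by
  obtain ⟨M, hM⟩ := hg.bounded_above_of_compact_support hgc
  refine tendsto_integral_of_dominated_convergence (fun x => M * ‖θ x‖) (fun n => ?_)
    (hθ.norm.const_mul M) (fun n => ae_of_all _ fun x => ?_) (ae_of_all _ fun x => ?_)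
  · have hcont := (contDiff_mollify (μ := μ) (ρ n) hg.locallyIntegrable).continuous
    exact hθ.1.mul (hcont.measurable.comp_aemeasurable hu).aestronglyMeasurable
  · rw [norm_mul, mul_comm, mollify_apply]
    gcongr
    simpa using norm_integral_le_of_norm_le_const (μ := bumpMeasure (ρ n) μ)
      (ae_of_all _ fun t => hM (u x - t))
  · exact (ContDiffBump.convolution_tendsto_right_of_continuous hρ hg (u x)).const_mul _

theorem exists_hasDegree_of_integral_fderiv_eq_zero [SFinite m] (hu : AEMeasurable u m)
    (hθ : Integrable θ m) {y₀ : E} {R : ℝ} (hR : 0 < R)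
    (hzero : ∀ g : E → ℝ, ContDiff ℝ 1 g → HasCompactSupport g → tsupport g ⊆ ball y₀ R →
      ∀ v : E, ∫ x, θ x * fderiv ℝ g (u x) v ∂m = 0) :
    ∃ c, HasDegree m u θ μ (ball y₀ R) c := by
  obtain ⟨ρ, hρ⟩ := exists_seq_contDiffBump_tendsto_rOut (E := E)
  have hmollify {g : E → ℝ} (hg : Continuous g) (hgc : HasCompactSupport g)
      (hgB : tsupport g ⊆ ball y₀ R) :
      ∀ᶠ n in atTop, ∫ x, θ x * mollify (ρ n) μ g (u x) ∂m =
        (∫ x, θ x * (ρ n).normed μ (u x - y₀) ∂m) * ∫ y, g y ∂μ := by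
    obtain ⟨R', hR', hgR'⟩ := exists_lt_subset_ball (isClosed_tsupport g) hgB
    filter_upwards [hρ.eventually_lt_const hR, hρ.eventually_lt_const (sub_pos.2 hR')] with n hn hn'
    rw [integral_mul_mollify_comp hu hθ (ρ n) hg hgc, ← integral_const_mul]
    congr with y
    by_cases hy : y ∈ tsupport g
    · rw [integral_mul_comp_sub_eq_of_integral_fderiv_eq_zero hu hθ hzero (ρ n).contDiff_normed
        (ρ n).tsupport_normed_eq.subset (ball_subset_ball (by linarith) (hgR' hy))
        (mem_ball_self (sub_pos.2 hn))]
    · rw [image_eq_zero_of_notMem_tsupport hy, mul_zero, mul_zero]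
  let b : ContDiffBump y₀ := ⟨R / 4, R / 2, by positivity, by linarith⟩
  have hbB : tsupport b ⊆ ball y₀ R := by
    rw [b.tsupport_eq]
    exact closedBall_subset_ball (half_lt_self hR)
  have hb : ∫ y, b y ∂μ ≠ 0 := b.integral_pos.ne'
  refine ⟨(∫ x, θ x * b (u x) ∂m) / ∫ y, b y ∂μ, fun g hg hgc hgB => ?_⟩
  rw [div_mul_eq_mul_div, eq_div_iff hb]
  refine tendsto_nhds_unique_of_eventuallyEq
    ((tendsto_integral_mul_mollify_comp (μ := μ) hu hθ hρ hg hgc).mul_const _)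
    ((tendsto_integral_mul_mollify_comp (μ := μ) hu hθ hρ b.continuous
      b.hasCompactSupport).mul_const _) ?_
  filter_upwards [hmollify hg hgc hgB, hmollify b.continuous b.hasCompactSupport hbB] with n hgn hbn
  rw [hgn, hbn, mul_right_comm]

end Degree

/-! ### Homeomorphisms -/

theorem exists_contDiff_one_nhds {E : Type*} [NormedAddCommGroup E] [NormedSpace ℝ E]
    [FiniteDimensional ℝ E] {C U : Set E} (hC : IsCompact C) (hU : IsOpen U) (hCU : C ⊆ U) :
    ∃ χ : E → ℝ, ContDiff ℝ ∞ χ ∧ HasCompactSupport χ ∧ tsupport χ ⊆ U ∧ ∀ x ∈ C, χ =ᶠ[𝓝 x] 1 := by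
  obtain ⟨V, hV, hCV, hVU⟩ := exists_compact_between hC hU hCU
  obtain ⟨χ, hχ1, hχ0, -⟩ := exists_contMDiffMap_one_nhds_of_subset_interior
    (n := (⊤ : ℕ∞)) (modelWithCornersSelf ℝ E) hC.isClosed hCV
  have hχV : tsupport χ ⊆ V :=
    closure_minimal (fun x hx => by_contra fun h => hx (hχ0 x h)) hV.isClosed
  exact ⟨χ, χ.contMDiff.contDiff, hV.of_isClosed_subset (isClosed_tsupport χ) hχV, hχV.trans hVU,
    fun x hx => hχ1.filter_mono (nhds_le_nhdsSet hx)⟩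

section OpenPartialHomeomorph

variable {X Y : Type*} [TopologicalSpace X] [TopologicalSpace Y] {φ : OpenPartialHomeomorph X Y}
  {F : Y → ℝ}

theorem symm_image_subset_source (φ : OpenPartialHomeomorph X Y) {S : Set Y} (hS : S ⊆ φ.target) :
    φ.symm '' S ⊆ φ.source :=
  image_subset_iff.2 fun _ hy => φ.map_target (hS hy)

theorem isCompact_symm_image (φ : OpenPartialHomeomorph X Y) {S : Set Y} (hS : IsCompact S)
    (hSt : S ⊆ φ.target) : IsCompact (φ.symm '' S) :=
  hS.image_of_continuousOn (φ.continuousOn_symm.mono hSt)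

theorem apply_notMem_tsupport {x : X} (hx : x ∈ φ.source \ φ.symm '' tsupport F) :
    φ x ∉ tsupport F :=
  fun h => hx.2 ⟨φ x, h, φ.left_inv hx.1⟩

theorem tsupport_indicator_source_comp_subset [T2Space X] (hFc : HasCompactSupport F)
    (hFt : tsupport F ⊆ φ.target) :
    tsupport (φ.source.indicator (F ∘ φ)) ⊆ φ.symm '' tsupport F := by
  refine closure_minimal (fun x hx => ?_) (isCompact_symm_image φ hFc hFt).isClosed
  have hxs : x ∈ φ.source := mem_of_indicator_ne_zero hx
  rw [Function.mem_support, indicator_of_mem hxs] at hx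
  exact ⟨φ x, subset_tsupport F hx, φ.left_inv hxs⟩

theorem continuous_indicator_source_comp [T2Space X] (hF : Continuous F)
    (hFc : HasCompactSupport F) (hFt : tsupport F ⊆ φ.target) :
    Continuous (φ.source.indicator (F ∘ φ)) := by
  refine continuous_of_tsupport fun x hx => ?_
  have hxs := symm_image_subset_source φ hFt (tsupport_indicator_source_comp_subset hFc hFt hx)
  refine (hF.continuousAt.comp (φ.continuousAt hxs)).congr ?_
  filter_upwards [φ.open_source.mem_nhds hxs] with y hy
  exact (indicator_of_mem hy _).symm

variable [T2Space X] [MeasurableSpace X] [OpensMeasurableSpace X] {μ : Measure X}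

theorem integrableOn_comp_smul {G : Type*} [NormedAddCommGroup G] [NormedSpace ℝ G]
    (hF : Continuous F) (hFc : HasCompactSupport F) (hFt : tsupport F ⊆ φ.target) {g : X → G}
    (hg : LocallyIntegrableOn g φ.source μ) :
    IntegrableOn (fun x => F (φ x) • g x) φ.source μ := by
  have hC := isCompact_symm_image φ hFc hFt
  have hCs := symm_image_subset_source φ hFt
  have hint : IntegrableOn (fun x => F (φ x) • g x) (φ.symm '' tsupport F) μ :=
    (hg.integrableOn_compact_subset hCs hC).continuousOn_smul
      (hF.comp_continuousOn (φ.continuousOn.mono hCs)) hC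
  refine hint.of_forall_sdiff_eq_zero φ.open_source.measurableSet fun x hx => ?_
  rw [image_eq_zero_of_notMem_tsupport (apply_notMem_tsupport hx), zero_smul]

end OpenPartialHomeomorph

section WeakHomeomorph

variable {φ : OpenPartialHomeomorph ℂ ℂ} {D : ℂ → ℂ →L[ℝ] ℂ}

theorem HasWeakL2FDeriv.locallyIntegrableOn_det {U : Set ℂ} {u : ℂ → ℂ}
    (hu : HasWeakL2FDeriv U u D) (hU : IsOpen U) : LocallyIntegrableOn (fun x => (D x).det) U :=
  (locallyIntegrableOn_iff hU.isLocallyClosed).2 fun C hCU hC =>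
    integrable_det_of_memLp_two (hu.memLp_deriv C hC hCU)

theorem HasWeakL2FDeriv.integral_comp_mul_fderiv_adj_source (hφ : HasWeakL2FDeriv φ.source φ D)
    {F p : ℂ → ℝ} (hF : ContDiff ℝ 1 F) (hFc : HasCompactSupport F)
    (hFt : tsupport F ⊆ φ.target) (hp : ContDiff ℝ 1 p) (v : ℂ) :
    ∫ x in φ.source, F (φ x) * fderiv ℝ p x (adj (D x) v) =
      -∫ x in φ.source, p x * fderiv ℝ F (φ x) v * (D x).det := by
  obtain ⟨χ, hχ, hχc, hχs, hχ1⟩ := exists_contDiff_one_nhds (isCompact_symm_image φ hFc hFt)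
    φ.open_source (symm_image_subset_source φ hFt)
  have hχp {x : ℂ} (hx : x ∈ φ.symm '' tsupport F) : (fun y => χ y * p y) =ᶠ[𝓝 x] p := by
    filter_upwards [hχ1 x hx] with y hy
    rw [hy, Pi.one_apply, one_mul]
  have key := hφ.integral_comp_mul_fderiv_adj φ.open_source hF hFc
    ((hχ.of_le (by simp)).mul hp) hχc.mul_right (tsupport_mul_subset_left.trans hχs) v
  have hleft : EqOn (fun x => F (φ x) * fderiv ℝ (fun y => χ y * p y) x (adj (D x) v))
      (fun x => F (φ x) * fderiv ℝ p x (adj (D x) v)) φ.source := by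
    intro x hx
    by_cases hxF : x ∈ φ.symm '' tsupport F
    · simp only [(hχp hxF).fderiv_eq]
    · simp only [image_eq_zero_of_notMem_tsupport (apply_notMem_tsupport ⟨hx, hxF⟩), zero_mul]
  have hright : EqOn (fun x => χ x * p x * fderiv ℝ F (φ x) v * (D x).det)
      (fun x => p x * fderiv ℝ F (φ x) v * (D x).det) φ.source := by
    intro x hx
    by_cases hxF : x ∈ φ.symm '' tsupport F
    · simp only [(hχp hxF).eq_of_nhds]
    · have hzero : fderiv ℝ F (φ x) = 0 := image_eq_zero_of_notMem_tsupport fun h =>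
        apply_notMem_tsupport ⟨hx, hxF⟩ (tsupport_fderiv_subset ℝ h)
      simp only [hzero, zero_apply, mul_zero, zero_mul]
  rwa [setIntegral_congr_fun φ.open_source.measurableSet hleft,
    setIntegral_congr_fun φ.open_source.measurableSet hright] at key

end WeakHomeomorph

section DegreeUnique

variable {E : Type*} [NormedAddCommGroup E] [MeasurableSpace E] {μ : Measure E} {X : Type*}
  [MeasurableSpace X] {m : Measure X} {u : X → E} {θ : X → ℝ} {B B' : Set E} {c c' : ℝ}

theorem HasDegree.mono (h : HasDegree m u θ μ B c) (hB : B' ⊆ B) : HasDegree m u θ μ B' c :=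
  fun g hg hgc hgB => h g hg hgc (hgB.trans hB)

variable [NormedSpace ℝ E] [FiniteDimensional ℝ E] [BorelSpace E]

theorem exists_tsupport_subset_integral_pos (μ : Measure E) [μ.IsOpenPosMeasure]
    [IsFiniteMeasureOnCompacts μ] (hB : IsOpen B) {y : E} (hy : y ∈ B) :
    ∃ g : E → ℝ, Continuous g ∧ HasCompactSupport g ∧ tsupport g ⊆ B ∧ 0 < ∫ y, g y ∂μ := by
  obtain ⟨g, hgB, hgc, hg, hg01, hgy⟩ :=
    exists_contDiff_tsupport_subset (n := 0) (hB.mem_nhds hy)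
  exact ⟨g, hg.continuous, hgc, hgB,
    hg.continuous.integral_pos_of_hasCompactSupport_nonneg_nonzero hgc
      (fun y => (hg01 (mem_range_self y)).1) (by rw [hgy]; exact one_ne_zero)⟩

theorem HasDegree.unique [μ.IsOpenPosMeasure] [IsFiniteMeasureOnCompacts μ]
    (h : HasDegree m u θ μ B c) (h' : HasDegree m u θ μ B c') (hB : IsOpen B) {y : E}
    (hy : y ∈ B) : c = c' := by
  obtain ⟨g, hg, hgc, hgB, hpos⟩ := exists_tsupport_subset_integral_pos μ hB hy
  exact mul_right_cancel₀ hpos.ne' ((h g hg hgc hgB).symm.trans (h' g hg hgc hgB))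

end DegreeUnique

section WeakHomeomorphDegree

variable {φ : OpenPartialHomeomorph ℂ ℂ} {D : ℂ → ℂ →L[ℝ] ℂ} {y₀ : ℂ} {R : ℝ}

theorem setIntegral_symm_image_mul_comp {θ g : ℂ → ℝ} {S : Set ℂ} (hSt : S ⊆ φ.target)
    (hg : tsupport g ⊆ S) :
    ∫ x in φ.symm '' S, θ x * g (φ x) = ∫ x in φ.source, θ x * g (φ x) := by
  refine (setIntegral_eq_of_subset_of_forall_sdiff_eq_zero φ.open_source.measurableSet
    (symm_image_subset_source φ hSt) fun x hx => ?_).symm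
  rw [image_eq_zero_of_notMem_tsupport (apply_notMem_tsupport
    ⟨hx.1, fun h => hx.2 (image_mono hg h)⟩), mul_zero]

theorem HasWeakL2FDeriv.integral_det_mul_fderiv_comp_eq_zero (hφ : HasWeakL2FDeriv φ.source φ D)
    {g : ℂ → ℝ} (hg : ContDiff ℝ 1 g) (hgc : HasCompactSupport g) (hgt : tsupport g ⊆ φ.target)
    (v : ℂ) : ∫ x in φ.source, (D x).det * fderiv ℝ g (φ x) v = 0 := by
  simpa [mul_comm] using
    hφ.integral_comp_mul_fderiv_adj_source hg hgc hgt (p := 1) contDiff_const v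

theorem HasWeakL2FDeriv.exists_hasDegree_ball_of_closedBall_subset
    (hφ : HasWeakL2FDeriv φ.source φ D) (hR : 0 < R) (hB : closedBall y₀ R ⊆ φ.target) :
    ∃ c, HasDegree (volume.restrict φ.source) φ (fun x => (D x).det) volume (ball y₀ R) c := by
  have hC := isCompact_symm_image φ (isCompact_closedBall y₀ R) hB
  have hCs := symm_image_subset_source φ hB
  have hzero (g : ℂ → ℝ) (hg : ContDiff ℝ 1 g) (hgc : HasCompactSupport g)
      (hgB : tsupport g ⊆ ball y₀ R) (v : ℂ) :
      ∫ x in φ.symm '' closedBall y₀ R, (D x).det * fderiv ℝ g (φ x) v = 0 := by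
    have hgB' := hgB.trans ball_subset_closedBall
    rw [setIntegral_symm_image_mul_comp (g := fun y => fderiv ℝ g y v) hB
      ((tsupport_fderiv_apply_subset ℝ v).trans hgB')]
    exact hφ.integral_det_mul_fderiv_comp_eq_zero hg hgc (hgB'.trans hB) v
  obtain ⟨c, hc⟩ := exists_hasDegree_of_integral_fderiv_eq_zero (μ := (volume : Measure ℂ))
    ((φ.continuousOn.mono hCs).aemeasurable hC.measurableSet)
    (integrable_det_of_memLp_two (hφ.memLp_deriv _ hC hCs)) hR hzero
  refine ⟨c, fun g hg hgc hgB => ?_⟩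
  rw [← setIntegral_symm_image_mul_comp hB (hgB.trans ball_subset_closedBall), hc g hg hgc hgB]

theorem HasWeakL2FDeriv.exists_hasDegree (hφ : HasWeakL2FDeriv φ.source φ D) (hR : 0 < R)
    (hφt : φ.target = ball y₀ R) :
    ∃ c, HasDegree (volume.restrict φ.source) φ (fun x => (D x).det) volume φ.target c := by
  have hball {r : ℝ} (hr : 0 < r) (hrR : r < R) :=
    hφ.exists_hasDegree_ball_of_closedBall_subset (y₀ := y₀) hr
      (hφt ▸ closedBall_subset_ball hrR)
  obtain ⟨c, hc⟩ := hball (half_pos hR) (half_lt_self hR)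
  refine ⟨c, fun g hg hgc hgt => ?_⟩
  obtain ⟨r, hrR, hgr⟩ := exists_lt_subset_ball (isClosed_tsupport g) (hφt ▸ hgt)
  have hhalf : 0 < max r (R / 2) := lt_max_of_lt_right (half_pos hR)
  obtain ⟨c', hc'⟩ := hball hhalf (max_lt hrR (half_lt_self hR))
  rw [hc.unique (hc'.mono (ball_subset_ball (le_max_right _ _))) isOpen_ball
    (mem_ball_self (half_pos hR))]
  exact hc' g hg hgc (hgr.trans (ball_subset_ball (le_max_left _ _)))

end WeakHomeomorphDegree

/-! ### The area formula -/

section Density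

variable {E : Type*} [NormedAddCommGroup E] [NormedSpace ℝ E] [FiniteDimensional ℝ E]
  [MeasurableSpace E] [BorelSpace E] {U : Set E} {m μ : Measure E} {j : E → ℝ}

theorem ae_eq_of_integral_contDiff_smul_eq_of_isOpen {F : Type*} [NormedAddCommGroup F]
    [NormedSpace ℝ F] [CompleteSpace F] {ν : Measure E} (hU : IsOpen U) {f f' : E → F}
    (hf : LocallyIntegrableOn f U ν) (hf' : LocallyIntegrableOn f' U ν)
    (h : ∀ g : E → ℝ, ContDiff ℝ ∞ g → HasCompactSupport g → tsupport g ⊆ U →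
      ∫ x, g x • f x ∂ν = ∫ x, g x • f' x ∂ν) :
    ∀ᵐ x ∂ν, x ∈ U → f x = f' x := by
  have hzero := hU.ae_eq_zero_of_integral_contDiff_smul_eq_zero (hf.sub hf')
    fun g hg hgc hgU => ?_
  · filter_upwards [hzero] with x hx hxU using sub_eq_zero.1 (hx hxU)
  have hint {f : E → F} (hf : LocallyIntegrableOn f U ν) : Integrable (fun x => g x • f x) ν := by
    have hfg : IntegrableOn (fun x => g x • f x) (tsupport g) ν :=
      (hf.integrableOn_compact_subset hgU hgc).continuousOn_smul hg.continuous.continuousOn hgc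
    exact (integrableOn_iff_integrable_of_support_subset
      ((Function.support_smul_subset_left g f).trans (subset_tsupport g))).1 hfg
  simp only [Pi.sub_apply, smul_sub]
  rw [integral_sub (hint hf) (hint hf'), h g hg hgc hgU, sub_self]

theorem integrableOn_toReal_rnDeriv_smul {X G : Type*} [MeasurableSpace X] [NormedAddCommGroup G]
    [NormedSpace ℝ G] {μ ν : Measure X} [SigmaFinite μ] [SigmaFinite ν] (hμν : μ ≪ ν) {f : X → G}
    {s : Set X} (hs : MeasurableSet s) (hf : IntegrableOn f s μ) :
    IntegrableOn (fun x => (μ.rnDeriv ν x).toReal • f x) s ν := by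
  rw [← integrable_indicator_iff hs] at hf ⊢
  exact ((integrable_rnDeriv_smul_iff hμν).2 hf).congr
    (ae_of_all _ fun x => (indicator_smul_apply s (fun x => (μ.rnDeriv ν x).toReal) f x).symm)

theorem ae_toReal_rnDeriv_eq_mul_of_integral_contDiff_eq [IsLocallyFiniteMeasure m]
    [IsLocallyFiniteMeasure μ] {ν : Measure E} [SigmaFinite ν] (hm : m ≪ ν) (hμ : μ ≪ ν)
    (hU : IsOpen U) (hj : LocallyIntegrableOn j U μ)
    (h : ∀ g : E → ℝ, ContDiff ℝ ∞ g → HasCompactSupport g → tsupport g ⊆ U →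
      ∫ x, g x ∂m = ∫ x, g x * j x ∂μ) :
    ∀ᵐ x ∂ν, x ∈ U → (m.rnDeriv ν x).toReal = (μ.rnDeriv ν x).toReal * j x := by
  have hfm : LocallyIntegrableOn (fun x => (m.rnDeriv ν x).toReal) U ν :=
    (locallyIntegrableOn_iff hU.isLocallyClosed).2 fun C _ hC =>
      Measure.integrableOn_toReal_rnDeriv hC.measure_lt_top.ne
  have hfμ : LocallyIntegrableOn (fun x => (μ.rnDeriv ν x).toReal * j x) U ν :=
    (locallyIntegrableOn_iff hU.isLocallyClosed).2 fun C hCU hC =>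
      integrableOn_toReal_rnDeriv_smul hμ hC.measurableSet (hj.integrableOn_compact_subset hCU hC)
  refine ae_eq_of_integral_contDiff_smul_eq_of_isOpen hU hfm hfμ fun g hg hgc hgU => ?_
  simp only [smul_eq_mul]
  calc ∫ x, g x * (m.rnDeriv ν x).toReal ∂ν = ∫ x, g x ∂m := by
        simp_rw [mul_comm (g _)]
        exact integral_rnDeriv_smul hm
    _ = ∫ x, g x * j x ∂μ := h g hg hgc hgU
    _ = ∫ x, g x * ((μ.rnDeriv ν x).toReal * j x) ∂ν := by
        simp_rw [mul_left_comm (g _)]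
        exact (integral_rnDeriv_smul hμ).symm

theorem ae_nonneg_and_restrict_eq_withDensity_of_integral_contDiff_eq [IsLocallyFiniteMeasure m]
    [IsLocallyFiniteMeasure μ] (hU : IsOpen U) (hj : LocallyIntegrableOn j U μ)
    (h : ∀ g : E → ℝ, ContDiff ℝ ∞ g → HasCompactSupport g → tsupport g ⊆ U →
      ∫ x, g x ∂m = ∫ x, g x * j x ∂μ) :
    (∀ᵐ x ∂μ.restrict U, 0 ≤ j x) ∧
      m.restrict U = (μ.restrict U).withDensity fun x => ENNReal.ofReal (j x) := by
  have hm : m ≪ m + μ := Measure.absolutelyContinuous_of_le (Measure.le_add_right le_rfl)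
  have hμ : μ ≪ m + μ := Measure.absolutelyContinuous_of_le (Measure.le_add_left le_rfl)
  have key := ae_toReal_rnDeriv_eq_mul_of_integral_contDiff_eq hm hμ hU hj h
  refine ⟨(ae_restrict_iff' hU.measurableSet).2 ?_, Measure.ext fun s hs => ?_⟩
  · filter_upwards [hμ.ae_le key, Measure.rnDeriv_pos hμ, hμ.ae_le (μ.rnDeriv_lt_top (m + μ))]
      with x hx hpos hlt hxU
    exact nonneg_of_mul_nonneg_right (ENNReal.toReal_nonneg.trans_eq (hx hxU))
      (ENNReal.toReal_pos hpos.ne' hlt.ne)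
  · rw [withDensity_apply _ hs, Measure.restrict_apply hs, Measure.restrict_restrict hs,
      ← Measure.setLIntegral_rnDeriv hm]
    conv_rhs => rw [← Measure.withDensity_rnDeriv_eq μ (m + μ) hμ]
    rw [setLIntegral_withDensity_eq_setLIntegral_mul_non_measurable₀ _
      (Measure.measurable_rnDeriv _ _).aemeasurable _ (hs.inter hU.measurableSet)
      (ae_restrict_of_ae (μ.rnDeriv_lt_top _))]
    refine setLIntegral_congr_fun_ae (hs.inter hU.measurableSet) ?_
    filter_upwards [key, m.rnDeriv_lt_top (m + μ), μ.rnDeriv_lt_top (m + μ)] with x hx hlm hlμ hxs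
    rw [Pi.mul_apply, ← ENNReal.ofReal_toReal hlm.ne, hx hxs.2,
      ENNReal.ofReal_mul ENNReal.toReal_nonneg, ENNReal.ofReal_toReal hlμ.ne]

end Density

section Injective

theorem HasWeakL2FDeriv.eq_of_ae_eq_zero {U : Set ℂ} {u : ℂ → ℂ} {D : ℂ → ℂ →L[ℝ] ℂ}
    (hu : HasWeakL2FDeriv U u D) (hU : IsOpen U) {x₀ x : ℂ} {r : ℝ} (hr : 0 < r)
    (hrU : closedBall x₀ (2 * r) ⊆ U)
    (hD : ∀ᵐ x ∂volume.restrict (closedBall x₀ (2 * r)), D x = 0) (hx : x ∈ ball x₀ r) :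
    u x = u x₀ := by
  have hV := isCompact_closedBall x₀ (2 * r)
  have hi : LocallyIntegrable ((closedBall x₀ (2 * r)).indicator u) :=
    ((hu.continuousOn.mono hrU).integrableOn_compact hV).integrable_indicator hV.measurableSet
      |>.locallyIntegrable
  have hD0 : (closedBall x₀ (2 * r)).indicator D =ᵐ[volume] 0 := by
    filter_upwards [(ae_restrict_iff' hV.measurableSet).1 hD] with y hy
    exact indicator_apply_eq_zero.2 hy
  have hDi : Integrable ((closedBall x₀ (2 * r)).indicator D) :=
    (integrable_congr hD0).2 (integrable_zero ℂ (ℂ →L[ℝ] ℂ) volume)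
  obtain ⟨ρ, hρ⟩ := exists_seq_contDiffBump_tendsto_rOut (E := ℂ)
  have hw := tendstoUniformlyOn_mollify_indicator (μ := (volume : Measure ℂ)) hV hr
    (C := closedBall x₀ r) (by rw [cthickening_closedBall hr.le hr.le, ← two_mul])
    (hu.continuousOn.mono hrU) hρ
  have hconst : ∀ᶠ n in atTop, mollify (ρ n) volume ((closedBall x₀ (2 * r)).indicator u) x =
      mollify (ρ n) volume ((closedBall x₀ (2 * r)).indicator u) x₀ := by
    filter_upwards [hρ.eventually_le_const hr] with n hn
    refine isOpen_ball.is_const_of_fderiv_eq_zero (𝕜 := ℝ) (convex_ball x₀ r).isPreconnected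
      ((contDiff_mollify (ρ n) hi).differentiable (by simp)).differentiableOn (fun y hy => ?_)
      hx (mem_ball_self hr)
    have hzero : mollify (ρ n) volume ((closedBall x₀ (2 * r)).indicator D) = 0 :=
      (convolution_congr _ EventuallyEq.rfl hD0).trans convolution_zero
    rw [hu.fderiv_mollify_indicator hU hrU hi
      hDi.locallyIntegrable (ρ n)
      (closedBall_subset_closedBall' (by linarith [mem_ball.1 hy])), hzero, Pi.zero_apply]
  exact tendsto_nhds_unique_of_eventuallyEq (hw.tendsto_at (ball_subset_closedBall hx))
    (hw.tendsto_at (mem_closedBall_self hr.le)) hconst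

theorem HasWeakL2FDeriv.not_ae_eq_zero {φ : OpenPartialHomeomorph ℂ ℂ} {D : ℂ → ℂ →L[ℝ] ℂ}
    (hφ : HasWeakL2FDeriv φ.source φ D) {U : Set ℂ} (hU : IsOpen U) (hUne : U.Nonempty)
    (hUs : U ⊆ φ.source) : ¬∀ᵐ x ∂volume.restrict U, D x = 0 := by
  intro hD
  obtain ⟨x₀, hx₀⟩ := hUne
  obtain ⟨r, hr, hrU⟩ := nhds_basis_closedBall.mem_iff.1 (hU.mem_nhds hx₀)
  have hball : closedBall x₀ (2 * (r / 2)) ⊆ U := by rwa [mul_div_cancel₀ r two_ne_zero]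
  obtain ⟨x, hx, hne⟩ : ∃ x ∈ ball x₀ (r / 2), x ≠ x₀ :=
    (infinite_of_mem_nhds x₀ (ball_mem_nhds x₀ (half_pos hr))).nontrivial.exists_ne x₀
  exact hne (φ.injOn (hUs (hball (ball_subset_closedBall
    (ball_subset_ball (by linarith) hx)))) (hUs hx₀) (hφ.eq_of_ae_eq_zero φ.open_source
    (half_pos hr) (hball.trans hUs) (ae_restrict_of_ae_restrict_of_subset hball hD) hx))

end Injective

section VolumeDensity

/-- `k` is the density of the measure `S ↦ volume (φ '' S)` on `φ.source`: the area formula for `φ`,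
with `k` in place of `|det Dφ|`. -/
structure HasVolumeDensity {X Y : Type*} [TopologicalSpace X] [MeasureSpace X] [TopologicalSpace Y]
    [MeasureSpace Y] (φ : OpenPartialHomeomorph X Y) (k : X → ℝ) : Prop where
  aemeasurable : AEMeasurable k (volume.restrict φ.source)
  ae_nonneg : ∀ᵐ x ∂volume.restrict φ.source, 0 ≤ k x
  map_symm : Measure.map φ.symm (volume.restrict φ.target) =
    (volume.restrict φ.source).withDensity fun x => ENNReal.ofReal (k x)

variable {E : Type*} [NormedAddCommGroup E] [MeasureSpace E] [BorelSpace E]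
  {φ : OpenPartialHomeomorph E E} {θ : E → ℝ} {c : ℝ}

theorem HasDegree.setIntegral_mul_eq
    (h : HasDegree (volume.restrict φ.source) φ θ volume φ.target c) {g : E → ℝ}
    (hg : Continuous g) (hgc : HasCompactSupport g) (hgs : tsupport g ⊆ φ.source) :
    ∫ x in φ.source, θ x * g x = c * ∫ y in φ.target, g (φ.symm y) := by
  have hC : IsCompact (φ '' tsupport g) := isCompact_symm_image φ.symm hgc hgs
  have hCt : φ '' tsupport g ⊆ φ.target := symm_image_subset_source φ.symm hgs
  have hsupp : tsupport (φ.target.indicator (g ∘ φ.symm)) ⊆ φ '' tsupport g :=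
    tsupport_indicator_source_comp_subset (φ := φ.symm) hgc hgs
  have hdeg := h (φ.target.indicator (g ∘ φ.symm))
    (continuous_indicator_source_comp (φ := φ.symm) hg hgc hgs)
    (hC.of_isClosed_subset (isClosed_tsupport _) hsupp) (hsupp.trans hCt)
  rw [integral_indicator φ.open_target.measurableSet] at hdeg
  refine (setIntegral_congr_fun φ.open_source.measurableSet fun x hx => ?_).trans hdeg
  simp only [indicator_of_mem (φ.map_source hx), Function.comp_apply, φ.left_inv hx]

variable [NormedSpace ℝ E] [FiniteDimensional ℝ E]

theorem HasDegree.ae_eq_zero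
    (h : HasDegree (volume.restrict φ.source) φ θ volume φ.target 0)
    (hθ : LocallyIntegrableOn θ φ.source) : ∀ᵐ x ∂volume.restrict φ.source, θ x = 0 := by
  refine (ae_restrict_iff' φ.open_source.measurableSet).2
    (φ.open_source.ae_eq_zero_of_integral_contDiff_smul_eq_zero hθ fun g hg hgc hgs => ?_)
  rw [← setIntegral_eq_integral_of_forall_compl_eq_zero (s := φ.source) fun x hx => by
    rw [image_eq_zero_of_notMem_tsupport fun hx' => hx (hgs hx'), zero_smul]]
  simpa [mul_comm] using h.setIntegral_mul_eq hg.continuous hgc hgs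

theorem HasDegree.hasVolumeDensity [IsLocallyFiniteMeasure (volume : Measure E)]
    (h : HasDegree (volume.restrict φ.source) φ θ volume φ.target c) (hc : c ≠ 0)
    (hθ : LocallyIntegrableOn θ φ.source) (hφt : volume φ.target ≠ ⊤) :
    HasVolumeDensity φ fun x => c⁻¹ * θ x := by
  have hφm : AEMeasurable φ.symm (volume.restrict φ.target) :=
    φ.continuousOn_symm.aemeasurable φ.open_target.measurableSet
  have : IsFiniteMeasure (volume.restrict φ.target) := isFiniteMeasure_restrict.2 hφt
  have hθ' : LocallyIntegrableOn (fun x => c⁻¹ * θ x) φ.source := hθ.smul c⁻¹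
  have hmem : ∀ᵐ x ∂Measure.map φ.symm (volume.restrict φ.target), x ∈ φ.source := by
    refine (ae_map_iff hφm φ.open_source.measurableSet).2 ?_
    filter_upwards [ae_restrict_mem φ.open_target.measurableSet] with y hy using φ.map_target hy
  have hint (g : E → ℝ) (hg : ContDiff ℝ ∞ g) (hgc : HasCompactSupport g)
      (hgs : tsupport g ⊆ φ.source) :
      ∫ x, g x ∂Measure.map φ.symm (volume.restrict φ.target) = ∫ x, g x * (c⁻¹ * θ x) := by
    calc ∫ x, g x ∂Measure.map φ.symm (volume.restrict φ.target)
        = ∫ y in φ.target, g (φ.symm y) := integral_map hφm hg.continuous.aestronglyMeasurable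
      _ = c⁻¹ * ∫ x in φ.source, θ x * g x := by
        rw [h.setIntegral_mul_eq hg.continuous hgc hgs, inv_mul_cancel_left₀ hc]
      _ = c⁻¹ * ∫ x, θ x * g x := by
        rw [setIntegral_eq_integral_of_forall_compl_eq_zero fun x hx => by
          rw [image_eq_zero_of_notMem_tsupport fun hx' => hx (hgs hx'), mul_zero]]
      _ = ∫ x, g x * (c⁻¹ * θ x) := by
        simp_rw [mul_left_comm (g _), integral_const_mul, mul_comm (g _)]
  obtain ⟨hpos, hmap⟩ :=
    ae_nonneg_and_restrict_eq_withDensity_of_integral_contDiff_eq φ.open_source hθ' hint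
  rw [Measure.restrict_eq_self_of_ae_mem hmem] at hmap
  exact ⟨hθ'.aestronglyMeasurable.aemeasurable, hpos, hmap⟩

end VolumeDensity

section ChangeOfVariables

variable {X Y : Type*} [TopologicalSpace X] [MeasureSpace X] [BorelSpace X] [TopologicalSpace Y]
  [MeasureSpace Y] [OpensMeasurableSpace Y] {φ : OpenPartialHomeomorph X Y} {k : X → ℝ}

theorem HasVolumeDensity.map_symm_restrict (h : HasVolumeDensity φ k) {T : Set X}
    (hT : MeasurableSet T) :
    Measure.map φ.symm (volume.restrict (φ.target ∩ φ.symm ⁻¹' T)) =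
      (volume.restrict (φ.source ∩ T)).withDensity fun x => ENNReal.ofReal (k x) := by
  have hm : AEMeasurable φ.symm (volume.restrict φ.target) :=
    φ.continuousOn_symm.aemeasurable φ.open_target.measurableSet
  rw [inter_comm φ.target, inter_comm φ.source, ← Measure.restrict_restrict hT,
    ← restrict_withDensity hT, ← h.map_symm, Measure.restrict_map_of_aemeasurable hm hT,
    Measure.restrict_restrict₀' φ.open_target.measurableSet.nullMeasurableSet]

theorem HasVolumeDensity.restr (h : HasVolumeDensity φ k) {U : Set X} (hU : IsOpen U) :
    HasVolumeDensity (φ.restr U) k := by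
  have hs : (φ.restr U).source = φ.source ∩ U := φ.restr_source' U hU
  have ht : (φ.restr U).target = φ.target ∩ φ.symm ⁻¹' U := by
    simp [hU.interior_eq]
  refine ⟨?_, ?_, ?_⟩
  · exact hs ▸ h.aemeasurable.mono_set inter_subset_left
  · exact hs ▸ ae_restrict_of_ae_restrict_of_subset inter_subset_left h.ae_nonneg
  · rw [hs, ht]
    exact h.map_symm_restrict hU.measurableSet

theorem HasVolumeDensity.setLIntegral_comp_symm (h : HasVolumeDensity φ k) {H : X → ℝ≥0∞}
    (hH : AEMeasurable H (volume.restrict φ.source)) {T : Set X} (hT : MeasurableSet T) :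
    ∫⁻ y in φ.target ∩ φ.symm ⁻¹' T, H (φ.symm y) =
      ∫⁻ x in φ.source ∩ T, ENNReal.ofReal (k x) * H x := by
  have hm : AEMeasurable φ.symm (volume.restrict (φ.target ∩ φ.symm ⁻¹' T)) :=
    (φ.continuousOn_symm.aemeasurable φ.open_target.measurableSet).mono_set inter_subset_left
  have hH' : AEMeasurable H (volume.restrict (φ.source ∩ T)) := hH.mono_set inter_subset_left
  rw [← lintegral_map' ((h.map_symm_restrict hT).symm ▸
      hH'.mono_ac (withDensity_absolutelyContinuous _ _)) hm, h.map_symm_restrict hT,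
    lintegral_withDensity_eq_lintegral_mul₀
      (h.aemeasurable.ennreal_ofReal.mono_set inter_subset_left) hH']
  rfl

theorem HasVolumeDensity.lintegral_comp_symm (h : HasVolumeDensity φ k) {H : X → ℝ≥0∞}
    (hH : AEMeasurable H (volume.restrict φ.source)) :
    ∫⁻ y in φ.target, H (φ.symm y) = ∫⁻ x in φ.source, ENNReal.ofReal (k x) * H x := by
  simpa using h.setLIntegral_comp_symm hH MeasurableSet.univ

theorem HasVolumeDensity.aestronglyMeasurable_comp_symm (h : HasVolumeDensity φ k) {G : Type*}
    [TopologicalSpace G] {H : X → G} (hH : AEStronglyMeasurable H (volume.restrict φ.source)) :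
    AEStronglyMeasurable (fun y => H (φ.symm y)) (volume.restrict φ.target) := by
  refine AEStronglyMeasurable.comp_aemeasurable (g := H) ?_
    (φ.continuousOn_symm.aemeasurable φ.open_target.measurableSet)
  rw [h.map_symm]
  exact hH.mono_ac (withDensity_absolutelyContinuous _ _)

theorem HasVolumeDensity.integral_comp_symm (h : HasVolumeDensity φ k) {G : Type*}
    [NormedAddCommGroup G] [NormedSpace ℝ G] {H : X → G}
    (hH : AEStronglyMeasurable H (volume.restrict φ.source)) :
    ∫ y in φ.target, H (φ.symm y) = ∫ x in φ.source, k x • H x := by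
  have hm : AEMeasurable φ.symm (volume.restrict φ.target) :=
    φ.continuousOn_symm.aemeasurable φ.open_target.measurableSet
  rw [← integral_map hm (h.map_symm ▸ hH.mono_ac (withDensity_absolutelyContinuous _ _)),
    h.map_symm, integral_withDensity_eq_integral_toReal_smul₀ h.aemeasurable.ennreal_ofReal
      (ae_of_all _ fun _ => ENNReal.ofReal_lt_top)]
  refine integral_congr_ae ?_
  filter_upwards [h.ae_nonneg] with x hx
  rw [ENNReal.toReal_ofReal hx]

end ChangeOfVariables

/-! ### Nonzero degrees are at least one in absolute value -/

section DegreeBound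

theorem HasDegree.subset_image {X E : Type*} [TopologicalSpace X] [MeasurableSpace X]
    [NormedAddCommGroup E] [NormedSpace ℝ E] [FiniteDimensional ℝ E] [MeasurableSpace E]
    [BorelSpace E] {m : Measure X} {μ : Measure E} [μ.IsOpenPosMeasure]
    [IsFiniteMeasureOnCompacts μ] {w : X → E} {θ : X → ℝ} {B : Set E} {c : ℝ}
    (h : HasDegree m w θ μ B c) (hc : c ≠ 0) (hB : IsOpen B) {C : Set X} (hC : IsCompact C)
    (hw : ContinuousOn w C) (hθ : ∀ x ∉ C, θ x = 0) : B ⊆ w '' C := by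
  intro y hy
  by_contra hyC
  obtain ⟨g, hg, hgc, hgB, hpos⟩ := exists_tsupport_subset_integral_pos μ
    (hB.sdiff (hC.image_of_continuousOn hw).isClosed) ⟨hy, hyC⟩
  have hzero : ∫ x, θ x * g (w x) ∂m = 0 := by
    refine integral_eq_zero_of_ae (ae_of_all _ fun x => ?_)
    by_cases hx : x ∈ C
    · have hgw : g (w x) = 0 :=
        image_eq_zero_of_notMem_tsupport fun hwx => (hgB hwx).2 (mem_image_of_mem w hx)
      simp [hgw]
    · simp [hθ x hx]
  exact mul_ne_zero hc hpos.ne' (hzero ▸ h g hg hgc (hgB.trans sdiff_subset)).symm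

theorem exists_hasDegree_mul_det_fderiv {w : ℂ → ℂ} {χ : ℂ → ℝ} {y₀ : ℂ} {a : ℝ} (ha : 0 < a)
    (hw : ContDiff ℝ 2 w) (hχ : ContDiff ℝ 1 χ) (hχc : HasCompactSupport χ)
    (hχw : ∀ x, w x ∈ ball y₀ a → fderiv ℝ χ x = 0) :
    ∃ c, HasDegree volume w (fun x => χ x * (fderiv ℝ w x).det) volume (ball y₀ a) c := by
  have hw' : Continuous fun x => (fderiv ℝ w x).det :=
    ContinuousLinearMap.continuous_det.comp (hw.continuous_fderiv two_ne_zero)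
  refine exists_hasDegree_of_integral_fderiv_eq_zero hw.continuous.aemeasurable
    ((hχ.continuous.mul hw').integrable_of_hasCompactSupport hχc.mul_right) ha
    fun g hg _ hgB v => ?_
  have hzero (x : ℂ) : g (w x) * fderiv ℝ χ x (adj (fderiv ℝ w x) v) = 0 := by
    by_cases hx : w x ∈ ball y₀ a
    · simp [hχw x hx]
    · simp [image_eq_zero_of_notMem_tsupport fun h => hx (hgB h)]
  have hparts := integral_comp_mul_fderiv_adj_fderiv hg hχ hχc hw v
  simp_rw [hzero, integral_zero, zero_eq_neg] at hparts
  simpa only [Pi.mul_apply, mul_right_comm] using hparts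

theorem measure_le_lintegral_abs_det_of_subset_image {w : ℕ → ℂ → ℂ} {D : ℂ → ℂ →L[ℝ] ℂ}
    {C V : Set ℂ} (hC : MeasurableSet C) (hw : ∀ n, ContDiff ℝ 1 (w n))
    (hD : MemLp D 2 (volume.restrict C))
    (hwD : Tendsto (fun n => eLpNorm (fderiv ℝ (w n) - D) 2 (volume.restrict C)) atTop (𝓝 0))
    (hV : ∀ᶠ n in atTop, V ⊆ w n '' C) :
    volume V ≤ ∫⁻ x in C, ENNReal.ofReal |(D x).det| := by
  have hw' (n : ℕ) : Continuous (fderiv ℝ (w n)) := (hw n).continuous_fderiv one_ne_zero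
  have hlim := (tendsto_eLpNorm_one_det_sub (fun n => (hw' n).aestronglyMeasurable) hD
    hwD).const_add (∫⁻ x in C, ENNReal.ofReal |(D x).det|)
  rw [add_zero] at hlim
  refine ge_of_tendsto hlim ?_
  filter_upwards [hV] with n hn
  have hDm : AEMeasurable (fun x => ENNReal.ofReal |(D x).det|) (volume.restrict C) :=
    (integrable_det_of_memLp_two hD).1.norm.aemeasurable.ennreal_ofReal
  calc volume V ≤ volume (w n '' C) := measure_mono hn
    _ ≤ ∫⁻ x in C, ENNReal.ofReal |(fderiv ℝ (w n) x).det| :=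
      addHaar_image_le_lintegral_abs_det_fderiv volume hC fun x _ =>
        ((hw n).differentiable one_ne_zero x).hasFDerivAt.hasFDerivWithinAt
    _ ≤ ∫⁻ x in C, (ENNReal.ofReal |(D x).det| + ‖(fderiv ℝ (w n) x).det - (D x).det‖ₑ) := by
      refine lintegral_mono fun x => ?_
      simp_rw [← Real.enorm_eq_ofReal_abs]
      simpa using enorm_add_le (D x).det ((fderiv ℝ (w n) x).det - (D x).det)
    _ = _ := by
      rw [lintegral_add_left' hDm, eLpNorm_one_eq_lintegral_enorm]
      rfl

theorem eventually_subset_image_tsupport {w : ℕ → ℂ → ℂ} {u : ℂ → ℂ} {D : ℂ → ℂ →L[ℝ] ℂ}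
    {χ : ℂ → ℝ} {B : Set ℂ} {c : ℝ} (hχ : Continuous χ) (hχc : HasCompactSupport χ)
    (hw : ∀ n, ContDiff ℝ 1 (w n)) (hwu : TendstoUniformlyOn w u atTop (tsupport χ))
    (hD : MemLp D 2 (volume.restrict (tsupport χ)))
    (hwD : Tendsto (fun n => eLpNorm (fderiv ℝ (w n) - D) 2 (volume.restrict (tsupport χ)))
      atTop (𝓝 0)) (hB : IsOpen B)
    (hdeg : ∀ᶠ n in atTop,
      ∃ c, HasDegree volume (w n) (fun x => χ x * (fderiv ℝ (w n) x).det) volume B c)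
    (h : HasDegree (volume.restrict (tsupport χ)) u (fun x => χ x * (D x).det) volume B c)
    (hc : c ≠ 0) : ∀ᶠ n in atTop, B ⊆ w n '' tsupport χ := by
  rcases B.eq_empty_or_nonempty with rfl | ⟨y, hy⟩
  · simp
  obtain ⟨g, hg, hgc, hgB, hpos⟩ := exists_tsupport_subset_integral_pos volume hB hy
  have hw' (n : ℕ) : Continuous (fderiv ℝ (w n)) := (hw n).continuous_fderiv one_ne_zero
  have hlim := tendsto_integral_mul_comp_mul (J := fun n x => (fderiv ℝ (w n) x).det)
    (J' := fun x => (D x).det) (isClosed_tsupport χ).measurableSet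
    (fun n => (hw n).continuous) hwu
    (fun n => (ContinuousLinearMap.continuous_det.comp (hw' n)).aestronglyMeasurable)
    (integrable_det_of_memLp_two hD)
    (tendsto_eLpNorm_one_det_sub (fun n => (hw' n).aestronglyMeasurable) hD hwD) hg hgc hχ hχc
  have hlimval := h g hg hgc hgB
  simp_rw [mul_right_comm (χ _)] at hlimval
  rw [hlimval] at hlim
  filter_upwards [hdeg, hlim.eventually_ne (mul_ne_zero hc hpos.ne')] with n ⟨cn, hcn⟩ hn
  have hval := hcn g hg hgc hgB
  simp_rw [mul_right_comm (χ _)] at hval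
  rw [setIntegral_eq_integral_of_forall_compl_eq_zero
    fun x hx => by simp [image_eq_zero_of_notMem_tsupport hx], hval] at hn
  exact hcn.subset_image (left_ne_zero_of_mul hn) hB hχc (hw n).continuous.continuousOn
    fun x hx => by rw [image_eq_zero_of_notMem_tsupport hx, zero_mul]

variable {φ : OpenPartialHomeomorph ℂ ℂ} {D : ℂ → ℂ →L[ℝ] ℂ} {y₀ : ℂ} {a b c : ℝ}

theorem fderiv_eq_zero_of_dist_lt {χ : ℂ → ℝ} {w : ℂ → ℂ} (hχ : tsupport χ ⊆ φ.source)
    (hχ1 : ∀ x ∈ φ.symm '' closedBall y₀ b, χ =ᶠ[𝓝 x] 1)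
    (hw : ∀ x ∈ tsupport χ, dist (φ x) (w x) < b - a) {x : ℂ} (hx : w x ∈ ball y₀ a) :
    fderiv ℝ χ x = 0 := by
  by_cases hxχ : x ∈ tsupport χ
  · have hφx : φ x ∈ closedBall y₀ b := by
      rw [mem_closedBall]
      linarith [dist_triangle (φ x) (w x) y₀, hw x hxχ, mem_ball.1 hx]
    rw [(hχ1 x ⟨φ x, hφx, φ.left_inv (hχ hxχ)⟩).fderiv_eq]
    exact fderiv_const_apply 1
  · exact image_eq_zero_of_notMem_tsupport fun h => hxχ (tsupport_fderiv_subset ℝ h)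

theorem HasWeakL2FDeriv.volume_ball_le_lintegral_abs_det (hφ : HasWeakL2FDeriv φ.source φ D)
    (ha : 0 < a) (hab : a < b) (hb : closedBall y₀ b ⊆ φ.target)
    (h : HasDegree (volume.restrict φ.source) φ (fun x => (D x).det) volume (ball y₀ a) c)
    (hc : c ≠ 0) : volume (ball y₀ a) ≤ ∫⁻ x in φ.source, ENNReal.ofReal |(D x).det| := by
  obtain ⟨χ, hχ, hχc, hχs, hχ1⟩ := exists_contDiff_one_nhds
    (isCompact_symm_image φ (isCompact_closedBall y₀ b) hb) φ.open_source
    (symm_image_subset_source φ hb)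
  have hD := hφ.memLp_deriv _ hχc hχs
  obtain ⟨w, hw, hwu, hwD⟩ := hφ.exists_seq_contDiff φ.open_source hχc hχs
  have hdeg : ∀ᶠ n in atTop, ∃ c,
      HasDegree volume (w n) (fun x => χ x * (fderiv ℝ (w n) x).det) volume (ball y₀ a) c := by
    filter_upwards [Metric.tendstoUniformlyOn_iff.1 hwu (b - a) (sub_pos.2 hab)] with n hn
    exact exists_hasDegree_mul_det_fderiv ha (contDiff_infty.1 (hw n) 2) (contDiff_infty.1 hχ 1)
      hχc fun x => fderiv_eq_zero_of_dist_lt hχs hχ1 hn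
  have h' : HasDegree (volume.restrict (tsupport χ)) φ (fun x => χ x * (D x).det) volume
      (ball y₀ a) c := by
    intro g hg hgc hgB
    rw [← h g hg hgc hgB, ← setIntegral_eq_of_subset_of_forall_sdiff_eq_zero
      φ.open_source.measurableSet hχs
      fun x hx => by simp [image_eq_zero_of_notMem_tsupport hx.2]]
    refine setIntegral_congr_fun φ.open_source.measurableSet fun x hx => ?_
    by_cases hφx : φ x ∈ ball y₀ a
    · have hφx' := ball_subset_closedBall (ball_subset_ball hab.le hφx)
      simp [(hχ1 x ⟨φ x, hφx', φ.left_inv hx⟩).eq_of_nhds]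
    · simp [image_eq_zero_of_notMem_tsupport fun hgx => hφx (hgB hgx)]
  have hw1 (n : ℕ) : ContDiff ℝ 1 (w n) := contDiff_infty.1 (hw n) 1
  have himage : ∀ᶠ n in atTop, ball y₀ a ⊆ w n '' tsupport χ :=
    eventually_subset_image_tsupport hχ.continuous hχc hw1 hwu hD hwD isOpen_ball hdeg h' hc
  exact (measure_le_lintegral_abs_det_of_subset_image (isClosed_tsupport χ).measurableSet hw1 hD
    hwD himage).trans (lintegral_mono_set hχs)

theorem HasWeakL2FDeriv.one_le_abs_of_hasDegree {R : ℝ} (hφ : HasWeakL2FDeriv φ.source φ D)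
    (hR : 0 < R) (hφt : φ.target = ball y₀ R)
    (h : HasDegree (volume.restrict φ.source) φ (fun x => (D x).det) volume φ.target c)
    (hc : c ≠ 0) : 1 ≤ |c| := by
  have hdens := h.hasVolumeDensity hc (hφ.locallyIntegrableOn_det φ.open_source)
    (hφt ▸ measure_ball_lt_top.ne)
  have harea : ∫⁻ x in φ.source, ENNReal.ofReal |(D x).det| =
      ENNReal.ofReal |c| * volume (ball y₀ R) := by
    calc ∫⁻ x in φ.source, ENNReal.ofReal |(D x).det|
        = ∫⁻ x in φ.source, ENNReal.ofReal (c⁻¹ * (D x).det) * ENNReal.ofReal |c| := by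
          refine lintegral_congr_ae ?_
          filter_upwards [hdens.ae_nonneg] with x hx
          rw [← ENNReal.ofReal_mul hx, ← abs_of_nonneg hx, ← abs_mul, mul_comm,
            mul_inv_cancel_left₀ hc]
      _ = ∫⁻ _ in φ.target, ENNReal.ofReal |c| :=
        (hdens.lintegral_comp_symm aemeasurable_const).symm
      _ = ENNReal.ofReal |c| * volume (ball y₀ R) := by rw [setLIntegral_const, hφt]
  have hle : volume (ball y₀ R) ≤ ENNReal.ofReal |c| * volume (ball y₀ R) := by
    refine (isOpen_ball.measure_eq_iSup_isCompact volume).trans_le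
      (iSup₂_le fun K hKR => iSup_le fun hK => ?_)
    obtain ⟨a, haR, hKa⟩ := exists_lt_subset_ball hK.isClosed hKR
    have hR' : 0 < max a (R / 2) := lt_max_of_lt_right (half_pos hR)
    obtain ⟨b, hab, hbR⟩ := exists_between (max_lt haR (half_lt_self hR))
    have hball : ball y₀ (max a (R / 2)) ⊆ φ.target := hφt ▸ ball_subset_ball (hab.trans hbR).le
    exact (measure_mono (hKa.trans (ball_subset_ball (le_max_left _ _)))).trans
      ((hφ.volume_ball_le_lintegral_abs_det hR' hab (hφt ▸ closedBall_subset_ball hbR)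
        (h.mono hball) hc).trans_eq harea)
  have hpos : volume (ball y₀ R) ≠ 0 := (measure_ball_pos volume y₀ hR).ne'
  rw [← ENNReal.ofReal_le_ofReal_iff (abs_nonneg c), ENNReal.ofReal_one]
  rwa [← ENNReal.mul_le_mul_iff_left hpos measure_ball_lt_top.ne, one_mul]

end DegreeBound

/-! ### The inverse of a homeomorphism of finite distortion -/

section Inverse

theorem eq_zero_of_det_eq_zero {A : ℂ →L[ℝ] ℂ} {K : ℝ} (h : ‖A‖ ^ 2 ≤ K * |A.det|)
    (h0 : A.det = 0) : A = 0 := by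
  rw [h0, abs_zero, mul_zero] at h
  exact norm_eq_zero.1 (sq_nonpos_iff _ |>.1 h)

variable {φ : OpenPartialHomeomorph ℂ ℂ} {D : ℂ → ℂ →L[ℝ] ℂ} {K c : ℝ}

theorem HasWeakL2FDeriv.aestronglyMeasurable_deriv {U : Set ℂ} {u : ℂ → ℂ}
    (hu : HasWeakL2FDeriv U u D) : AEStronglyMeasurable D (volume.restrict U) :=
  hu.locallyIntegrableOn_deriv.aestronglyMeasurable

theorem HasVolumeDensity.memLp_inverse_comp_symm
    (h : HasVolumeDensity φ fun x => c⁻¹ * (D x).det)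
    (hD : AEStronglyMeasurable D (volume.restrict φ.source)) (hK : 0 ≤ K)
    (hdist : ∀ᵐ x ∂volume.restrict φ.source, ‖D x‖ ^ 2 ≤ K * |(D x).det|) {C : Set ℂ}
    (hC : IsCompact C) (hCt : C ⊆ φ.target) :
    MemLp (fun y => (D (φ.symm y)).inverse) 2 (volume.restrict C) := by
  have hinv := aestronglyMeasurable_inverse hD
  have hC' : IsCompact (φ.symm '' C) := isCompact_symm_image φ hC hCt
  have hpre : φ.target ∩ φ.symm ⁻¹' (φ.symm '' C) = C := by
    rw [inter_comm]
    exact φ.symm.injOn.preimage_image_inter hCt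
  have hbound : ∀ᵐ x ∂volume.restrict (φ.source ∩ φ.symm '' C),
      ENNReal.ofReal (c⁻¹ * (D x).det) * ‖(D x).inverse‖ₑ ^ 2 ≤
        ENNReal.ofReal (|c|⁻¹ * (‖adj‖ ^ 2 * K)) := by
    filter_upwards [ae_restrict_of_ae_restrict_of_subset inter_subset_left hdist] with x hx
    rw [← ofReal_norm, ← ENNReal.ofReal_pow (norm_nonneg _), ← ENNReal.ofReal_mul' (by positivity)]
    refine ENNReal.ofReal_le_ofReal ?_
    calc c⁻¹ * (D x).det * ‖(D x).inverse‖ ^ 2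
        ≤ |c⁻¹ * (D x).det| * ‖(D x).inverse‖ ^ 2 := by gcongr; exact le_abs_self _
      _ = |c|⁻¹ * (|(D x).det| * ‖(D x).inverse‖ ^ 2) := by rw [abs_mul, abs_inv, mul_assoc]
      _ ≤ |c|⁻¹ * (‖adj‖ ^ 2 * K) :=
        mul_le_mul_of_nonneg_left (abs_det_mul_norm_inverse_sq_le hK hx) (by positivity)
  refine ⟨(h.aestronglyMeasurable_comp_symm hinv).mono_set hCt, ?_⟩
  rw [eLpNorm_lt_top_iff_lintegral_rpow_enorm_lt_top two_ne_zero ENNReal.ofNat_ne_top]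
  simp only [ENNReal.toReal_ofNat, ENNReal.rpow_ofNat]
  rw [← hpre, h.setLIntegral_comp_symm (H := fun x => ‖(D x).inverse‖ₑ ^ 2)
    (hinv.enorm.pow_const 2) hC'.measurableSet]
  refine (lintegral_mono_ae hbound).trans_lt ?_
  rw [setLIntegral_const]
  exact ENNReal.mul_lt_top ENNReal.ofReal_lt_top
    ((measure_mono inter_subset_right).trans_lt hC'.measure_lt_top)

theorem HasWeakL2FDeriv.integral_fderiv_comp_smul_det_smul (hφ : HasWeakL2FDeriv φ.source φ D)
    {η : ℂ → ℝ} (hη : ContDiff ℝ 1 η) (hηc : HasCompactSupport η) (hηt : tsupport η ⊆ φ.target)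
    (v : ℂ) :
    ∫ x in φ.source, fderiv ℝ η (φ x) v • ((D x).det • x) =
      -∫ x in φ.source, η (φ x) • adj (D x) v := by
  have hdet : LocallyIntegrableOn (fun x => (D x).det • x) φ.source :=
    (hφ.locallyIntegrableOn_det φ.open_source).smul_continuousOn
      φ.open_source.isLocallyClosed continuousOn_id
  have hadj : LocallyIntegrableOn (fun x => adj (D x) v) φ.source := by
    refine (locallyIntegrableOn_iff φ.open_source.isLocallyClosed).2 fun C hCs hC => ?_
    exact (ContinuousLinearMap.apply ℝ ℂ v ∘L adj).integrable_comp
      (hφ.locallyIntegrableOn_deriv.integrableOn_compact_subset hCs hC)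
  have hleft : IntegrableOn (fun x => fderiv ℝ η (φ x) v • ((D x).det • x)) φ.source :=
    integrableOn_comp_smul (φ := φ) (F := fun y => fderiv ℝ η y v)
      ((hη.continuous_fderiv one_ne_zero).clm_apply continuous_const) (hηc.fderiv_apply ℝ v)
      ((tsupport_fderiv_apply_subset ℝ v).trans hηt) hdet
  have hright : IntegrableOn (fun x => η (φ x) • adj (D x) v) φ.source :=
    integrableOn_comp_smul hη.continuous hηc hηt hadj
  have hcoord (ℓ : ℂ →L[ℝ] ℝ) :
      ℓ (∫ x in φ.source, fderiv ℝ η (φ x) v • ((D x).det • x)) =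
        ℓ (-∫ x in φ.source, η (φ x) • adj (D x) v) := by
    have hparts := hφ.integral_comp_mul_fderiv_adj_source hη hηc hηt ℓ.contDiff v
    simp only [ContinuousLinearMap.fderiv] at hparts
    rw [map_neg, ← ℓ.integral_comp_comm hleft, ← ℓ.integral_comp_comm hright]
    simp only [map_smul, smul_eq_mul]
    rw [hparts, neg_neg]
    exact integral_congr_ae (ae_of_all _ fun x => by ring)
  exact Complex.ext (hcoord Complex.reCLM) (hcoord Complex.imCLM)

theorem HasVolumeDensity.integral_smul_comp_symm {k q : ℂ → ℝ} (h : HasVolumeDensity φ k)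
    (hq : Continuous q) {H : ℂ → ℂ} (hH : AEStronglyMeasurable H (volume.restrict φ.source)) :
    ∫ y in φ.target, q y • H (φ.symm y) = ∫ x in φ.source, k x • (q (φ x) • H x) := by
  have hqφ : AEStronglyMeasurable (fun x => q (φ x)) (volume.restrict φ.source) :=
    (hq.comp_continuousOn φ.continuousOn).aestronglyMeasurable φ.open_source.measurableSet
  refine Eq.trans ?_ (h.integral_comp_symm (H := fun x => q (φ x) • H x) (hqφ.smul hH))
  refine setIntegral_congr_fun φ.open_target.measurableSet fun y hy => ?_
  simp only [φ.right_inv hy]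

theorem HasWeakL2FDeriv.symm (hφ : HasWeakL2FDeriv φ.source φ D) (hK : 0 ≤ K)
    (hdist : ∀ᵐ x ∂volume.restrict φ.source, ‖D x‖ ^ 2 ≤ K * |(D x).det|)
    (h : HasVolumeDensity φ fun x => c⁻¹ * (D x).det) :
    HasWeakL2FDeriv φ.target φ.symm fun y => (D (φ.symm y)).inverse := by
  have hD := hφ.aestronglyMeasurable_deriv
  have hmem (C : Set ℂ) (hC : IsCompact C) (hCt : C ⊆ φ.target) :
      MemLp (fun y => (D (φ.symm y)).inverse) 2 (volume.restrict C) :=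
    h.memLp_inverse_comp_symm hD hK hdist hC hCt
  refine { locallyIntegrableOn := φ.continuousOn_symm.locallyIntegrableOn
             φ.open_target.measurableSet
           locallyIntegrableOn_deriv := (locallyIntegrableOn_iff
             φ.open_target.isLocallyClosed).2 fun C hCt hC => ?_
           continuousOn := φ.continuousOn_symm
           memLp_deriv := hmem
           integral_eq := fun η hη hηc hηt v => ?_ }
  · have : IsFiniteMeasure (volume.restrict C) := isFiniteMeasure_restrict.2 hC.measure_lt_top.ne
    exact (hmem C hC hCt).integrable one_le_two
  have hη1 : ContDiff ℝ 1 η := contDiff_infty.1 hη 1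
  calc ∫ y in φ.target, fderiv ℝ η y v • φ.symm y
      = ∫ x in φ.source, (c⁻¹ * (D x).det) • (fderiv ℝ η (φ x) v • x) :=
        h.integral_smul_comp_symm ((hη1.continuous_fderiv one_ne_zero).clm_apply continuous_const)
          aestronglyMeasurable_id
    _ = c⁻¹ • ∫ x in φ.source, fderiv ℝ η (φ x) v • ((D x).det • x) := by
      rw [← integral_smul]
      simp only [smul_smul, mul_comm, mul_left_comm]
    _ = c⁻¹ • -∫ x in φ.source, η (φ x) • adj (D x) v := by
      rw [hφ.integral_fderiv_comp_smul_det_smul hη1 hηc hηt]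
    _ = -∫ x in φ.source, (c⁻¹ * (D x).det) • (η (φ x) • (D x).inverse v) := by
      rw [smul_neg, ← integral_smul]
      refine congrArg Neg.neg (integral_congr_ae ?_)
      filter_upwards [hdist] with x hx
      rcases eq_or_ne (D x).det 0 with h0 | h0
      · simp [eq_zero_of_det_eq_zero hx h0]
      · simp [inverse_eq_inv_det_smul_adj, h0, mul_comm, mul_left_comm]
    _ = -∫ y in φ.target, η y • (D (φ.symm y)).inverse v := by
      rw [← h.integral_smul_comp_symm hη.continuous
        ((aestronglyMeasurable_inverse hD).apply_continuousLinearMap v)]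

end Inverse

/-! ### The Jacobian of a homeomorphism of finite distortion -/

section Jacobian

theorem HasVolumeDensity.ae_mul_eq_of_hasDegree_symm {E : Type*} [NormedAddCommGroup E]
    [NormedSpace ℝ E] [FiniteDimensional ℝ E] [MeasureSpace E] [BorelSpace E]
    [IsLocallyFiniteMeasure (volume : Measure E)] {φ : OpenPartialHomeomorph E E} {k θ : E → ℝ}
    {c : ℝ} (h : HasVolumeDensity φ k) (hθ : AEStronglyMeasurable θ (volume.restrict φ.source))
    (hkθ : LocallyIntegrableOn (fun x => k x * θ x) φ.source)
    (hdeg : HasDegree (volume.restrict φ.target) φ.symm (fun y => θ (φ.symm y)) volume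
      φ.source c) :
    ∀ᵐ x ∂volume.restrict φ.source, k x * θ x = c := by
  have hc : LocallyIntegrableOn (fun _ => c) φ.source :=
    (locallyIntegrable_const c).locallyIntegrableOn _
  refine (ae_restrict_iff' φ.open_source.measurableSet).2
    (ae_eq_of_integral_contDiff_smul_eq_of_isOpen φ.open_source hkθ hc fun g hg hgc hgs => ?_)
  have hchange := h.integral_comp_symm (H := fun x => θ x * g x)
    (hθ.mul hg.continuous.aestronglyMeasurable)
  rw [hdeg g hg.continuous hgc hgs, setIntegral_eq_integral_of_forall_compl_eq_zero fun x hx => by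
    simp [image_eq_zero_of_notMem_tsupport fun h => hx (hgs h)]] at hchange
  simp only [smul_eq_mul, integral_mul_const]
  rw [mul_comm, hchange]
  exact integral_congr_ae (ae_of_all _ fun x => by ring)

theorem locallyIntegrableOn_mul_mul_inv {X : Type*} [TopologicalSpace X] [LocallyCompactSpace X]
    [MeasurableSpace X] {μ : Measure X} [IsFiniteMeasureOnCompacts μ]
    {U : Set X} (hU : IsOpen U) {J : X → ℝ} (hJ : AEMeasurable J (μ.restrict U)) {a : ℝ} :
    LocallyIntegrableOn (fun x => a * J x * (J x)⁻¹) U μ := by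
  refine (locallyIntegrableOn_iff hU.isLocallyClosed).2 fun C hCU hC => ?_
  have : IsFiniteMeasure (μ.restrict C) := isFiniteMeasure_restrict.2 hC.measure_lt_top.ne
  refine (integrable_const |a|).mono'
    (((hJ.const_mul a).mul hJ.inv).mono_set hCU).aestronglyMeasurable (ae_of_all _ fun x => ?_)
  rw [mul_assoc, norm_mul]
  refine mul_le_of_le_one_right (norm_nonneg _) ?_
  by_cases h0 : J x = 0 <;> simp [h0]

theorem ae_restrict_of_forall_exists_mem_nhds {X : Type*} [TopologicalSpace X]
    [SecondCountableTopology X] [MeasurableSpace X] {μ : Measure X} {s : Set X}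
    (hs : MeasurableSet s) {p : X → Prop}
    (h : ∀ x ∈ s, ∃ t ∈ 𝓝 x, ∀ᵐ z ∂μ.restrict t, p z) : ∀ᵐ z ∂μ.restrict s, p z := by
  rw [ae_iff, Measure.restrict_apply' hs]
  refine measure_null_of_locally_null _ fun x hx => ?_
  obtain ⟨t, ht, hp⟩ := h x hx.2
  refine ⟨_, inter_mem_nhdsWithin _ ht, measure_mono_null ?_
    (le_zero_iff.1 ((Measure.le_restrict_apply t _).trans_eq (ae_iff.1 hp)))⟩
  exact inter_subset_inter_left _ inter_subset_left

variable {U V : Set ℂ} {u : ℂ → ℂ} {D : ℂ → ℂ →L[ℝ] ℂ}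

theorem HasWeakL2FDeriv.mono (hu : HasWeakL2FDeriv U u D) (hVU : V ⊆ U) :
    HasWeakL2FDeriv V u D where
  locallyIntegrableOn := hu.locallyIntegrableOn.mono_set hVU
  locallyIntegrableOn_deriv := hu.locallyIntegrableOn_deriv.mono_set hVU
  continuousOn := hu.continuousOn.mono hVU
  memLp_deriv C hC hCV := hu.memLp_deriv C hC (hCV.trans hVU)
  integral_eq η hη hηc hηV v := by
    have hη0 {x : ℂ} (hx : x ∉ V) : η x = 0 := image_eq_zero_of_notMem_tsupport fun h => hx (hηV h)
    have hη0' {x : ℂ} (hx : x ∉ V) : fderiv ℝ η x = 0 :=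
      image_eq_zero_of_notMem_tsupport fun h => hx (hηV (tsupport_fderiv_subset ℝ h))
    have h := hu.integral_eq η hη hηc (hηV.trans hVU) v
    rw [setIntegral_eq_integral_of_forall_compl_eq_zero fun x hx => by
        simp [hη0' fun h => hx (hVU h)],
      setIntegral_eq_integral_of_forall_compl_eq_zero fun x hx => by
        simp [hη0 fun h => hx (hVU h)]] at h
    rwa [setIntegral_eq_integral_of_forall_compl_eq_zero fun x hx => by simp [hη0' hx],
      setIntegral_eq_integral_of_forall_compl_eq_zero fun x hx => by simp [hη0 hx]]

variable {φ : OpenPartialHomeomorph ℂ ℂ} {K R c : ℝ} {x₀ : ℂ}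

theorem HasWeakL2FDeriv.not_ae_det_eq_zero (hφ : HasWeakL2FDeriv φ.source φ D)
    (hne : φ.source.Nonempty)
    (hdist : ∀ᵐ x ∂volume.restrict φ.source, ‖D x‖ ^ 2 ≤ K * |(D x).det|) :
    ¬∀ᵐ x ∂volume.restrict φ.source, (D x).det = 0 := fun h0 =>
  hφ.not_ae_eq_zero φ.open_source hne subset_rfl <| by
    filter_upwards [h0, hdist] with x hx hx' using eq_zero_of_det_eq_zero hx' hx

theorem HasWeakL2FDeriv.ae_det_ne_zero_and_abs_le_one_of_source_eq_ball
    (hφ : HasWeakL2FDeriv φ.source φ D) (hK : 0 ≤ K)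
    (hdist : ∀ᵐ x ∂volume.restrict φ.source, ‖D x‖ ^ 2 ≤ K * |(D x).det|)
    (h : HasVolumeDensity φ fun x => c⁻¹ * (D x).det) (hc : c ≠ 0) (hR : 0 < R)
    (hφs : φ.source = ball x₀ R) :
    (∀ᵐ x ∂volume.restrict φ.source, (D x).det ≠ 0) ∧ |c| ≤ 1 := by
  have hψ : HasWeakL2FDeriv φ.symm.source φ.symm fun y => (D (φ.symm y)).inverse :=
    hφ.symm hK hdist h
  obtain ⟨c', hdeg⟩ := hψ.exists_hasDegree hR hφs
  simp only [det_inverse] at hdeg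
  have hdet : AEMeasurable (fun x => (D x).det) (volume.restrict φ.source) :=
    (hφ.locallyIntegrableOn_det φ.open_source).aestronglyMeasurable.aemeasurable
  have hconst : ∀ᵐ x ∂volume.restrict φ.source, c⁻¹ * (D x).det * (D x).det⁻¹ = c' :=
    h.ae_mul_eq_of_hasDegree_symm hdet.inv.aestronglyMeasurable
      (locallyIntegrableOn_mul_mul_inv φ.open_source hdet) hdeg
  have hnot := hφ.not_ae_det_eq_zero (hφs ▸ nonempty_ball.2 hR) hdist
  have hc' : c' ≠ 0 := by
    rintro rfl
    refine hnot ?_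
    filter_upwards [hconst] with x hx
    by_contra h0
    exact mul_ne_zero (mul_ne_zero (inv_ne_zero hc) h0) (inv_ne_zero h0) hx
  have hne : ∀ᵐ x ∂volume.restrict φ.source, (D x).det ≠ 0 := by
    filter_upwards [hconst] with x hx h0
    exact hc' (by rw [← hx, h0, mul_zero, zero_mul])
  have : NeBot (ae (volume.restrict φ.source)) := by
    refine ⟨fun hbot => hnot ?_⟩
    rw [hbot]
    exact eventually_bot
  obtain ⟨x, hx, hx0⟩ := (hconst.and hne).exists
  rw [mul_inv_cancel_right₀ hx0] at hx
  have hle : 1 ≤ |c|⁻¹ := by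
    rw [← abs_inv, hx]
    exact hψ.one_le_abs_of_hasDegree hR hφs (by simpa only [det_inverse] using hdeg) hc'
  exact ⟨hne, (one_le_inv₀ (abs_pos.2 hc)).1 hle⟩

theorem HasWeakL2FDeriv.ae_det_ne_zero_and_abs_le_one (hφ : HasWeakL2FDeriv φ.source φ D)
    (hne : φ.source.Nonempty) (hK : 0 ≤ K)
    (hdist : ∀ᵐ x ∂volume.restrict φ.source, ‖D x‖ ^ 2 ≤ K * |(D x).det|)
    (h : HasVolumeDensity φ fun x => c⁻¹ * (D x).det) (hc : c ≠ 0) :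
    (∀ᵐ x ∂volume.restrict φ.source, (D x).det ≠ 0) ∧ |c| ≤ 1 := by
  have hlocal {x : ℂ} (hx : x ∈ φ.source) : ∃ R > 0,
      (∀ᵐ z ∂volume.restrict (ball x R), (D z).det ≠ 0) ∧ |c| ≤ 1 := by
    obtain ⟨R, hR, hRs⟩ := nhds_basis_ball.mem_iff.1 (φ.open_source.mem_nhds hx)
    have hs : (φ.restr (ball x R)).source = ball x R := by
      rw [φ.restr_source' _ isOpen_ball, inter_eq_right.2 hRs]
    have hball := HasWeakL2FDeriv.ae_det_ne_zero_and_abs_le_one_of_source_eq_ball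
      (φ := φ.restr (ball x R)) (hs.symm ▸ hφ.mono hRs) hK
      (hs.symm ▸ ae_restrict_of_ae_restrict_of_subset hRs hdist) (h.restr isOpen_ball) hc hR hs
    exact ⟨R, hR, hs ▸ hball⟩
  obtain ⟨x₁, hx₁⟩ := hne
  exact ⟨ae_restrict_of_forall_exists_mem_nhds φ.open_source.measurableSet fun x hx =>
    let ⟨R, hR, hae, _⟩ := hlocal hx
    ⟨ball x R, ball_mem_nhds x hR, hae⟩, (hlocal hx₁).choose_spec.2.2⟩

end Jacobian

section BallTarget

variable {D : ℂ → ℂ →L[ℝ] ℂ} {φ : OpenPartialHomeomorph ℂ ℂ} {K R c : ℝ} {y₀ : ℂ}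

theorem HasVolumeDensity.abs_of_abs_eq_one {X Y : Type*} [TopologicalSpace X] [MeasureSpace X]
    [TopologicalSpace Y] [MeasureSpace Y] {φ : OpenPartialHomeomorph X Y} {θ : X → ℝ}
    (h : HasVolumeDensity φ fun x => c⁻¹ * θ x) (hc : |c| = 1) :
    HasVolumeDensity φ fun x => |θ x| := by
  have habs : (fun x => c⁻¹ * θ x) =ᵐ[volume.restrict φ.source] fun x => |θ x| := by
    filter_upwards [h.ae_nonneg] with x hx
    rw [← abs_of_nonneg hx, abs_mul, abs_inv, hc, inv_one, one_mul]
  refine ⟨h.aemeasurable.congr habs, ae_of_all _ fun x => abs_nonneg _, ?_⟩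
  rw [h.map_symm]
  exact withDensity_congr_ae (habs.fun_comp ENNReal.ofReal)

theorem HasWeakL2FDeriv.exists_hasVolumeDensity_of_target_eq_ball
    (hφ : HasWeakL2FDeriv φ.source φ D) (hK : 0 ≤ K)
    (hdist : ∀ᵐ x ∂volume.restrict φ.source, ‖D x‖ ^ 2 ≤ K * |(D x).det|) (hR : 0 < R)
    (hφt : φ.target = ball y₀ R) :
    ∃ c : ℝ, |c| = 1 ∧ (∀ᵐ x ∂volume.restrict φ.source, (D x).det ≠ 0) ∧
      HasVolumeDensity φ fun x => c⁻¹ * (D x).det := by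
  obtain ⟨c, hdeg⟩ := hφ.exists_hasDegree hR hφt
  have hdet : LocallyIntegrableOn (fun x => (D x).det) φ.source :=
    hφ.locallyIntegrableOn_det φ.open_source
  have hne : φ.source.Nonempty := ⟨φ.symm y₀, φ.map_target (hφt ▸ mem_ball_self hR)⟩
  have hc : c ≠ 0 := by
    rintro rfl
    exact hφ.not_ae_det_eq_zero hne hdist (hdeg.ae_eq_zero hdet)
  have hdens := hdeg.hasVolumeDensity hc hdet (hφt ▸ measure_ball_lt_top.ne)
  obtain ⟨hdet0, hc1⟩ := hφ.ae_det_ne_zero_and_abs_le_one hne hK hdist hdens hc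
  exact ⟨c, le_antisymm hc1 (hφ.one_le_abs_of_hasDegree hR hφt hdeg hc), hdet0, hdens⟩

end BallTarget

/-! ### Quasiconformal mappings onto a disc -/

section Quasiconformal

theorem WeaklyDifferentiableOn.hasWeakFDeriv {U : Set ℂ} {u : ℂ → ℂ}
    (hu : WeaklyDifferentiableOn U u) : HasWeakFDeriv U u (weakFDeriv U u) := by
  rw [weakFDeriv, dif_pos hu]
  exact hu.choose_spec

theorem HasWeakFDeriv.ae_eq {U : Set ℂ} {u : ℂ → ℂ} {D D' : ℂ → ℂ →L[ℝ] ℂ}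
    (hD : HasWeakFDeriv U u D) (hD' : HasWeakFDeriv U u D') (hU : IsOpen U) :
    D =ᵐ[volume.restrict U] D' := by
  have hloc {A : ℂ → ℂ →L[ℝ] ℂ} (hA : LocallyIntegrableOn A U) (v : ℂ) :
      LocallyIntegrableOn (fun x => A x v) U (volume.restrict U) := fun x hx =>
    let ⟨s, hs, hAs⟩ := hA x hx
    ⟨s, hs, (hAs.apply_continuousLinearMap v).mono_measure <|
      Measure.restrict_mono subset_rfl Measure.restrict_le_self⟩
  have heq (v : ℂ) : ∀ᵐ x ∂volume.restrict U, D x v = D' x v := by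
    filter_upwards [ae_restrict_mem hU.measurableSet, ae_eq_of_integral_contDiff_smul_eq_of_isOpen
      hU (hloc hD.locallyIntegrableOn_deriv v) (hloc hD'.locallyIntegrableOn_deriv v)
      fun η hη hηc hηU => neg_injective <| (hD.integral_eq η hη hηc hηU v).symm.trans <|
        hD'.integral_eq η hη hηc hηU v] with x hxU hx using hx hxU
  filter_upwards [heq 1, heq Complex.I] with x h1 hI
  ext v
  rw [apply_eq_re_smul_add_im_smul, h1, hI, ← apply_eq_re_smul_add_im_smul]

variable {K R : ℝ} {φ : OpenPartialHomeomorph ℂ ℂ} {y₀ : ℂ}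

theorem IsQuasiconformal.hasWeakL2FDeriv (hφ : IsQuasiconformal K φ) :
    HasWeakL2FDeriv φ.source φ (weakFDeriv φ.source φ) where
  toHasWeakFDeriv := hφ.memSobolevLoc.weaklyDifferentiableOn.hasWeakFDeriv
  continuousOn := φ.continuousOn
  memLp_deriv := hφ.memSobolevLoc.memLp_deriv

theorem IsQuasiconformal.exists_hasVolumeDensity (hφ : IsQuasiconformal K φ) (hR : 0 < R)
    (hφt : φ.target = ball y₀ R) :
    ∃ c : ℝ, |c| = 1 ∧ (∀ᵐ x ∂volume.restrict φ.source, jacobian φ.source φ x ≠ 0) ∧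
      HasVolumeDensity φ fun x => c⁻¹ * jacobian φ.source φ x :=
  hφ.hasWeakL2FDeriv.exists_hasVolumeDensity_of_target_eq_ball (zero_le_one.trans hφ.one_le)
    hφ.distortion hR hφt

theorem IsQuasiconformal.ae_jacobian_symm_eq (hφ : IsQuasiconformal K φ) (hR : 0 < R)
    (hφt : φ.target = ball y₀ R) :
    ∀ᵐ y ∂volume.restrict φ.target,
      jacobian φ.target φ.symm y = (jacobian φ.source φ (φ.symm y))⁻¹ := by
  obtain ⟨c, -, -, hdens⟩ := hφ.exists_hasVolumeDensity hR hφt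
  have hψ : HasWeakFDeriv φ.target φ.symm fun y => (weakFDeriv φ.source φ (φ.symm y)).inverse :=
    (hφ.hasWeakL2FDeriv.symm (zero_le_one.trans hφ.one_le) hφ.distortion hdens).toHasWeakFDeriv
  have hw : WeaklyDifferentiableOn φ.target φ.symm := ⟨_, hψ⟩
  filter_upwards [hw.hasWeakFDeriv.ae_eq hψ φ.open_target] with y hy
  rw [jacobian, hy, det_inverse, jacobian]

end Quasiconformal

/-! ### The embedding of the weighted Lebesgue space -/

section Embedding

theorem HasVolumeDensity.lintegral_enorm_rpow_le {X Y : Type*} [TopologicalSpace X]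
    [MeasureSpace X] [BorelSpace X] [TopologicalSpace Y] [MeasureSpace Y] [OpensMeasurableSpace Y]
    {φ : OpenPartialHomeomorph X Y} {k : X → ℝ} (hφ : HasVolumeDensity φ k)
    (hk : ∀ᵐ x ∂volume.restrict φ.source, k x ≠ 0) {E : Type*} [NormedAddCommGroup E] {f : X → E}
    (hf : AEStronglyMeasurable f (volume.restrict φ.source)) {p q s : ℝ}
    (hpq : p.HolderConjugate q) :
    ∫⁻ x in φ.source, ‖f x‖ₑ ^ s ≤
      (∫⁻ x in φ.source, ENNReal.ofReal (k x) * ‖f x‖ₑ ^ (s * p)) ^ (1 / p) *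
        (∫⁻ y in φ.target, ENNReal.ofReal (k (φ.symm y))⁻¹ ^ q) ^ (1 / q) := by
  have hkinv : AEMeasurable (fun x => ENNReal.ofReal (k x)⁻¹) (volume.restrict φ.source) :=
    hφ.aemeasurable.inv.ennreal_ofReal
  calc ∫⁻ x in φ.source, ‖f x‖ₑ ^ s
      = ∫⁻ x in φ.source, ENNReal.ofReal (k x) * (‖f x‖ₑ ^ s * ENNReal.ofReal (k x)⁻¹) := by
        refine lintegral_congr_ae ?_
        filter_upwards [hk, hφ.ae_nonneg] with x hx hx'
        rw [mul_left_comm, ← ENNReal.ofReal_mul hx', mul_inv_cancel₀ hx, ENNReal.ofReal_one,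
          mul_one]
    _ = ∫⁻ y in φ.target, ‖f (φ.symm y)‖ₑ ^ s * ENNReal.ofReal (k (φ.symm y))⁻¹ :=
        (hφ.lintegral_comp_symm ((hf.enorm.pow_const s).mul hkinv)).symm
    _ ≤ (∫⁻ y in φ.target, (‖f (φ.symm y)‖ₑ ^ s) ^ p) ^ (1 / p) *
          (∫⁻ y in φ.target, ENNReal.ofReal (k (φ.symm y))⁻¹ ^ q) ^ (1 / q) :=
        ENNReal.lintegral_mul_le_Lp_mul_Lq _ hpq
          ((hφ.aestronglyMeasurable_comp_symm hf).enorm.pow_const s)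
          (hφ.aestronglyMeasurable_comp_symm hkinv.aestronglyMeasurable).aemeasurable
    _ = _ := by
        simp only [← ENNReal.rpow_mul]
        rw [hφ.lintegral_comp_symm (H := fun x => ‖f x‖ₑ ^ (s * p)) (hf.enorm.pow_const _)]

theorem weightedNorm_eq_lintegral_enorm {p : ℝ} (hp : 0 ≤ p) (Ω : Set ℂ) (v f : ℂ → ℝ) :
    weightedNorm p Ω v f = (∫⁻ x in Ω, ENNReal.ofReal (v x) * ‖f x‖ₑ ^ p) ^ (1 / p) := by
  simp_rw [weightedNorm, mul_comm _ (v _), Real.enorm_eq_ofReal_abs]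
  congr 2 with x
  rw [ENNReal.ofReal_rpow_of_nonneg (abs_nonneg _) hp, ENNReal.ofReal_mul' (by positivity)]

theorem weightedNorm_congr {p : ℝ} {Ω : Set ℂ} (hΩ : MeasurableSet Ω) {v w : ℂ → ℝ}
    (hvw : ∀ x ∈ Ω, v x = w x) (f : ℂ → ℝ) : weightedNorm p Ω v f = weightedNorm p Ω w f :=
  congrArg (· ^ (1 / p)) <| setLIntegral_congr_fun hΩ fun x hx => by simp only [hvw x hx]

variable {K α s : ℝ} {Ω : Set ℂ} {φ : OpenPartialHomeomorph ℂ ℂ}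

theorem IsRegularMap.inverseJacobianIntegral_eq (hφ : IsRegularMap K α Ω φ) (hα : 0 ≤ α) :
    inverseJacobianIntegral α φ = ∫⁻ y in φ.target,
      ENNReal.ofReal |jacobian φ.source φ (φ.symm y)|⁻¹ ^ (α / 2) := by
  rw [inverseJacobianIntegral, ← hφ.target_eq]
  refine lintegral_congr_ae ?_
  filter_upwards [hφ.isQuasiconformal.ae_jacobian_symm_eq one_pos hφ.target_eq] with y hy
  rw [hy, abs_inv, ENNReal.ofReal_rpow_of_nonneg (by positivity) (by positivity)]

theorem IsRegularMap.lintegral_enorm_rpow_le (hφ : IsRegularMap K α Ω φ) (hα : 2 < α)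
    {f : ℂ → ℝ} (hf : AEStronglyMeasurable f (volume.restrict Ω)) (s : ℝ) :
    ∫⁻ x in Ω, ‖f x‖ₑ ^ s ≤
      (∫⁻ x in Ω, ENNReal.ofReal |jacobian Ω φ x| * ‖f x‖ₑ ^ (s * (α / (α - 2)))) ^
          (1 / (α / (α - 2))) *
        inverseJacobianIntegral α φ ^ (1 / (α / 2)) := by
  obtain ⟨c, hc, hJ, hdens⟩ :=
    hφ.isQuasiconformal.exists_hasVolumeDensity one_pos hφ.target_eq
  have hα2 : 0 < α - 2 := sub_pos.2 hα
  have hpq : (α / (α - 2)).HolderConjugate (α / 2) := by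
    rw [Real.holderConjugate_iff, one_lt_div hα2, inv_div, inv_div]
    exact ⟨by linarith, by field_simp; ring⟩
  rw [hφ.inverseJacobianIntegral_eq (by linarith)]
  obtain rfl := hφ.source_eq
  exact (hdens.abs_of_abs_eq_one hc).lintegral_enorm_rpow_le
    (hJ.mono fun x => abs_ne_zero.2) hf hpq

theorem IsRegularMap.eLpNorm_le (hφ : IsRegularMap K α Ω φ) (hα : 2 < α) {f : ℂ → ℝ}
    (hf : AEStronglyMeasurable f (volume.restrict Ω)) (hs : 0 < s) :
    eLpNorm f (ENNReal.ofReal s) (volume.restrict Ω) ≤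
      inverseJacobianIntegral α φ ^ (2 / α * (1 / s)) *
        weightedNorm (s * (α / (α - 2))) Ω (fun x => |jacobian Ω φ x|) f := by
  have : 0 < α - 2 := sub_pos.2 hα
  rw [eLpNorm_eq_lintegral_rpow_enorm_toReal (by simpa using hs) ENNReal.ofReal_ne_top,
    ENNReal.toReal_ofReal hs.le, weightedNorm_eq_lintegral_enorm (by positivity)]
  refine (ENNReal.rpow_le_rpow (hφ.lintegral_enorm_rpow_le hα hf s)
    (by positivity)).trans_eq ?_
  rw [ENNReal.mul_rpow_of_nonneg _ _ (by positivity), ← ENNReal.rpow_mul, ← ENNReal.rpow_mul,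
    mul_comm, one_div_div, one_div_mul_one_div,
    mul_comm _ s]

end Embedding

end

end PlanarQC

theorem lemmaL2p3_general (K α : ℝ) (hα : 2 < α) (Ω : Set ℂ) (φ : OpenPartialHomeomorph ℂ ℂ)
    (hφ : PlanarQC.IsRegularMap K α Ω φ)
    (h : ℂ → ℝ) (hh : ∀ x ∈ Ω, h x = |PlanarQC.jacobian Ω φ x|)
    (r s : ℝ) (hr : 0 < r) (hs : s = (α - 2) / α * r)
    (f : ℂ → ℝ) (hf : PlanarQC.MemWeightedLp r Ω h f) :
    MemLp f (ENNReal.ofReal s) (volume.restrict Ω) ∧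
    eLpNorm f (ENNReal.ofReal s) (volume.restrict Ω) ≤
      PlanarQC.inverseJacobianIntegral α φ ^ (2 / α * (1 / s)) *
        PlanarQC.weightedNorm r Ω h f := by
  have hα2 : 0 < α - 2 := sub_pos.2 hα
  have hs0 : 0 < s := by rw [hs]; positivity
  have hsr : s * (α / (α - 2)) = r := by rw [hs]; field_simp
  have hΩ : MeasurableSet Ω := hφ.source_eq ▸ φ.open_source.measurableSet
  have hle : eLpNorm f (ENNReal.ofReal s) (volume.restrict Ω) ≤
      PlanarQC.inverseJacobianIntegral α φ ^ (2 / α * (1 / s)) *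
        PlanarQC.weightedNorm r Ω h f := by
    rw [PlanarQC.weightedNorm_congr hΩ hh, ← hsr]
    exact hφ.eLpNorm_le hα hf.1 hs0
  have hfinite : PlanarQC.inverseJacobianIntegral α φ ^ (2 / α * (1 / s)) < ⊤ :=
    ENNReal.rpow_lt_top_of_nonneg (by positivity) hφ.integral_lt_top.ne
  exact ⟨⟨hf.1, hle.trans_lt (ENNReal.mul_lt_top hfinite hf.2)⟩, hle⟩

theorem lemmaL2p3 (K α : ℝ) (Ω : Set ℂ) (hΩ : PlanarQC.IsRegularDomain K α Ω)
    (φ : OpenPartialHomeomorph ℂ ℂ) (hφ : PlanarQC.IsRegularMap K α Ω φ)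
    (h : ℂ → ℝ) (hh : ∀ x ∈ Ω, h x = |PlanarQC.jacobian Ω φ x|)
    (r s : ℝ) (hr : α / (α - 2) ≤ r) (hs : s = (α - 2) / α * r)
    (f : ℂ → ℝ) (hf : PlanarQC.MemWeightedLp r Ω h f) :
    MemLp f (ENNReal.ofReal s) (volume.restrict Ω) ∧
    eLpNorm f (ENNReal.ofReal s) (volume.restrict Ω) ≤
      PlanarQC.inverseJacobianIntegral α φ ^ (2 / α * (1 / s)) *
        PlanarQC.weightedNorm r Ω h f :=
  have hr0 : 0 < r := (div_pos (two_pos.trans hΩ.two_lt) (sub_pos.2 hΩ.two_lt)).trans_le hr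
  lemmaL2p3_general K α hΩ.two_lt Ω φ hφ h hh r s hr0 hs f hf
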